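/- Let $\varphi:(0,\infty)\to[0,\infty)$ be nondecreasing with $\varphi(0^+)=0$ and $\lim_{s\to\infty}\varphi(s)=\infty$, let $\varphi^{-1}(s)=\inf\{t>0:\varphi(t)>s\}$ be its generalized inverse, and let $\Phi(t)=\int_0^t\varphi(s)\,ds$ and $\Psi(t)=\int_0^t\varphi^{-1}(s)\,ds$ be the corresponding Young function and its complementary function (with $\Phi(\infty)=\infty$). Fix $\gamma>-1$. For measurable $f$ on $\mathbb R$ put $$\|f\|=\inf\Big\{\lambda>0:\int_{\mathbb R}\Phi\Big(\frac{|f(x)|}{\lambda}\Big)|x|^\gamma\,dx\le 1\Big\}\in[0,\infty],$$ let $L_{\Phi,|x|^\gamma}(\mathbb R)$ be the class of measurable $f:\mathbb R\to\mathbb R$ with $\int_{\mathbb R}\Phi(k|f(x)|)|x|^\gamma\,dx<\infty$ for some $k>0$, and let $(Mf)(x)=\sup_{I\ni x}\frac1{|I|}\int_I|f(y)|\,dy\in[0,\infty]$ be the Hardy--Littlewood maximal function, the supremum being over the bounded nondegenerate intervals $I$ containing $x$. Then the following assertions are equivalent. 1. There is $L>0$ such that $\|Mf\|\le L\|f\|$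 for all measurable $f:\mathbb R\to\mathbb R$. 2. $M$ maps $L_{\Phi,|x|^\gamma}(\mathbb R)$ into itself (that is, for $f$ in this class, $Mf$ is finite almost everywhere and belongs to the class). 3. $M$ maps $L_{\Phi,|x|^\gamma}(\mathbb R)$ into itself and is continuous for the metric $d(f,g)=\|f-g\|$. 4. There is $K>0$ such that $\int_{\mathbb R}\Phi\big((Mf)(x)\big)|x|^\gamma\,dx\le\int_{\mathbb R}\Phi\big(K|f(y)|\big)|y|^\gamma\,dy$ for all measurable $f:\mathbb R\to\mathbb R$. 5. There is $C\ge1$ such that $\Psi(2t)\le C\,\Psi(t)$ for all $t>0$, and either $-1<\gamma<0$, or $\gamma\ge0$ and $$\frac1t\int_0^t\varphi^{-1}(s^{-\gamma})\,ds\le C\,\varphi^{-1}(Ct^{-\gamma})\qquad\text{for all }t>0.$$ -/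

import Mathlib

open MeasureTheory Set Filter Topology
open scoped ENNReal

noncomputable section

namespace PowerOrlicz

/-- `φ`, restricted to `(0,∞)`, is the density of a Young function: it is nondecreasing with
`φ(0⁺) = 0` and `φ(s) → ∞` as `s → ∞`. (Values of `φ` on `(-∞,0]` are never used; jumps and
intervals of constancy are allowed.) -/
structure IsYoungDensity (φ : ℝ → ℝ) : Prop where
  monotoneOn : MonotoneOn φ (Ioi 0)
  tendsto_zero : Tendsto φ (𝓝[>] 0) (𝓝 0)
  tendsto_atTop : Tendsto φ atTop atTop

/-- The (right-continuous) generalized inverse `φ⁻¹(s) = inf {t > 0 : φ(t) > s}`. -/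
def densityInv (φ : ℝ → ℝ) (s : ℝ) : ℝ := sInf {t : ℝ | 0 < t ∧ s < φ t}

/-- `Φ(x) = ∫₀ˣ φ(s) ds` for `x ∈ [0,∞]`; in particular `Φ(∞) = ∞` for a Young density. -/
def youngFn (φ : ℝ → ℝ) (x : ℝ≥0∞) : ℝ≥0∞ :=
  ∫⁻ s in {s : ℝ | 0 < s ∧ ENNReal.ofReal s < x}, ENNReal.ofReal (φ s)

/-- The complementary Young function `Ψ(x) = ∫₀ˣ φ⁻¹(s) ds`. -/
def complYoungFn (φ : ℝ → ℝ) (x : ℝ≥0∞) : ℝ≥0∞ := youngFn (densityInv φ) x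

/-- The modular `∫_ℝ Φ(g(x)) |x|^γ dx` of a function `g : ℝ → [0,∞]`. -/
def modular (φ : ℝ → ℝ) (γ : ℝ) (g : ℝ → ℝ≥0∞) : ℝ≥0∞ :=
  ∫⁻ x : ℝ, youngFn φ (g x) * ENNReal.ofReal (|x| ^ γ)

/-- The norm `inf {c > 0 : ∫_ℝ Φ(g(x)/c) |x|^γ dx ≤ 1}` in `[0,∞]`, for `g : ℝ → [0,∞]`
(with `inf ∅ = ∞`). For a real function `f` it is applied to `g = |f|`. -/
def luxNorm (φ : ℝ → ℝ) (γ : ℝ) (g : ℝ → ℝ≥0∞) : ℝ≥0∞ :=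
  sInf {c : ℝ≥0∞ | 0 < c ∧ c ≠ ∞ ∧ modular φ γ (fun x => g x / c) ≤ 1}

/-- The Orlicz class of Lebesgue measurable `f : ℝ → ℝ` with `∫_ℝ Φ(k|f(x)|) |x|^γ dx < ∞` for
some `k > 0`. (For real functions, Lebesgue measurable is the same as `AEMeasurable`.) -/
def orliczClass (φ : ℝ → ℝ) (γ : ℝ) : Set (ℝ → ℝ) :=
  {f | AEMeasurable f volume ∧
    ∃ k : ℝ, 0 < k ∧ modular φ γ (fun x => ENNReal.ofReal (k * |f x|)) < ∞}

/-- The uncentered Hardy–Littlewood maximal function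
`(Mf)(x) = sup_{I ∋ x} |I|⁻¹ ∫_I |f(y)| dy`, over bounded nondegenerate intervals `I`, with values
in `[0,∞]`. -/
def maximalFn (f : ℝ → ℝ) (x : ℝ) : ℝ≥0∞ :=
  ⨆ (a : ℝ) (b : ℝ) (_ : a < b) (_ : x ∈ Icc a b),
    (∫⁻ y in Icc a b, ENNReal.ofReal |f y|) / ENNReal.ofReal (b - a)

/-- `M` maps the Orlicz class into itself: for `f` in the class, `Mf` is finite a.e. and
(as a real function) belongs to the class. -/
def MapsClass (φ : ℝ → ℝ) (γ : ℝ) : Prop :=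
  ∀ f ∈ orliczClass φ γ, (∀ᵐ x ∂(volume : Measure ℝ), maximalFn f x ≠ ∞) ∧
    (fun x => (maximalFn f x).toReal) ∈ orliczClass φ γ

/-- `M` is continuous on the Orlicz class for the metric `d(f,g) = ‖f - g‖` of the norm. -/
def ContinuousOnClass (φ : ℝ → ℝ) (γ : ℝ) : Prop :=
  ∀ f ∈ orliczClass φ γ, ∀ ε : ℝ≥0∞, 0 < ε → ∃ δ : ℝ≥0∞, 0 < δ ∧ ∀ g ∈ orliczClass φ γ,
    luxNorm φ γ (fun x => ENNReal.ofReal |f x - g x|) < δ →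
    luxNorm φ γ (fun x => ENNReal.ofReal |(maximalFn f x).toReal - (maximalFn g x).toReal|) < ε

end PowerOrlicz

end

noncomputable section

namespace PowerOrlicz

/-! Everything passes through one property of `φ`: with `σ = max γ 0`, `GrowthCondition φ σ` asks
that `φ (B * v) ≥ 2 * B ^ σ * φ v` for some `B > 1`. Then `φ` grows faster than a power slightly
above `σ`, so `Φ` behaves like a power `p > 1 + σ`, for which `|x|^γ` is a Muckenhoupt `A_p` weight.

The four statements about `M` are linked by soft arguments. A condensation argument turns the
mapping property into a norm bound on the modular unit ball (`MapsClass.boundedOnUnitBall`).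
Dilations commute with `M` and multiply the modular by `ρ ^ (γ + 1)`, so this bound at level one
gives the modular inequality at every level (`BoundedOnUnitBall.modularBounded`). Homogeneity then
yields the norm inequality, and sublinearity of `M` yields continuity.

Growth follows from the modular inequality by testing on multiples of indicators of intervals:
dyadic shells give a sum bound for `φ` whose many comparable terms force a gain over the power `σ`.
Conversely, growth gives `∫₀ᵘ φ(s) s^(-p) ds ≲ u^(-p) Φ(2u)`, and the weak type `(p,p)` bound for
`f` truncated at height `s / 2` is integrated against `φ(s) ds`.

Growth is matched with the condition on `Ψ` by passing to the inverse `φ⁻¹`. For `γ ≤ 0` doubling of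
`Ψ` is enough. For `γ > 0` the averaging inequality improves itself: the primitive of `φ⁻¹(s^(-γ))`
decays geometrically under halving. -/

theorem lintegral_comp_mul_left {c : ℝ} (hc : 0 < c) (f : ℝ → ℝ≥0∞) :
    ENNReal.ofReal c * ∫⁻ x, f (c * x) = ∫⁻ x, f x := by
  have h := Real.smul_map_volume_mul_left hc.ne'
  rw [abs_of_pos hc] at h
  have h2 : ∫⁻ x, f x ∂(Measure.map (c * ·) volume) = ∫⁻ x, f (c * x) :=
    lintegral_map_equiv f (Homeomorph.mulLeft₀ c hc.ne').toMeasurableEquiv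
  conv_rhs => rw [← h]
  rw [lintegral_smul_measure, h2, smul_eq_mul]

theorem setLIntegral_comp_mul_left {c : ℝ} (hc : 0 < c) {S : Set ℝ} (hS : MeasurableSet S)
    (f : ℝ → ℝ≥0∞) :
    ENNReal.ofReal c * ∫⁻ x in (fun x => c * x) ⁻¹' S, f (c * x) = ∫⁻ x in S, f x := by
  rw [← lintegral_indicator hS, ← lintegral_indicator (hS.preimage (measurable_const_mul c)),
    ← lintegral_comp_mul_left hc (S.indicator f)]
  rfl

/-! ### Young functions: scaling and comparison with `x * φ x`. -/

section Young

variable {φ : ℝ → ℝ}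

theorem measurableSet_youngCut (x : ℝ≥0∞) :
    MeasurableSet {s : ℝ | 0 < s ∧ ENNReal.ofReal s < x} :=
  (measurableSet_lt measurable_const measurable_id).inter
    (measurableSet_lt ENNReal.measurable_ofReal measurable_const)

theorem youngCut_ofReal (t : ℝ) :
    {s : ℝ | 0 < s ∧ ENNReal.ofReal s < ENNReal.ofReal t} = Ioo 0 t := by
  ext s
  simp only [mem_ofPred_eq, mem_Ioo]
  refine and_congr_right fun hs => ?_
  rw [ENNReal.ofReal_lt_ofReal_iff_of_nonneg hs.le]

theorem youngFn_ofReal (φ : ℝ → ℝ) (t : ℝ) :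
    youngFn φ (ENNReal.ofReal t) = ∫⁻ s in Ioo 0 t, ENNReal.ofReal (φ s) := by
  rw [youngFn, youngCut_ofReal]

theorem youngFn_mono (φ : ℝ → ℝ) : Monotone (youngFn φ) := fun _ _ h =>
  lintegral_mono_set fun _ hs => ⟨hs.1, hs.2.trans_le h⟩

theorem measurable_youngFn (φ : ℝ → ℝ) : Measurable (youngFn φ) := (youngFn_mono φ).measurable

theorem youngFn_zero (φ : ℝ → ℝ) : youngFn φ 0 = 0 := by simp [youngFn]

/-- The domain of integration attached to a supremum is the union of those attached to the terms.
This lets a supremum replace a series in the condensation argument. -/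
theorem youngFn_iSup_le (φ : ℝ → ℝ) (g : ℕ → ℝ≥0∞) :
    youngFn φ (⨆ n, g n) ≤ ∑' n, youngFn φ (g n) := by
  refine le_trans (lintegral_mono_set ?_) (lintegral_iUnion_le _ _)
  rintro s ⟨h0, h⟩
  obtain ⟨n, hn⟩ := lt_iSup_iff.1 h
  exact mem_iUnion.2 ⟨n, h0, hn⟩

theorem youngFn_scale (hφ : MonotoneOn φ (Ioi 0)) {c : ℝ} (hc : 0 < c) (hc1 : c ≤ 1)
    (x : ℝ≥0∞) : youngFn φ (ENNReal.ofReal c * x) ≤ ENNReal.ofReal c * youngFn φ x := by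
  rw [youngFn, ← setLIntegral_comp_mul_left hc (measurableSet_youngCut _)]
  refine mul_le_mul_right (le_trans (lintegral_mono_set (t := {s : ℝ | 0 < s ∧ ENNReal.ofReal s < x}) ?_)
    (setLIntegral_mono' (measurableSet_youngCut _) ?_)) _
  · rintro s ⟨h0, h⟩
    refine ⟨pos_of_mul_pos_right h0 hc.le, ?_⟩
    rw [ENNReal.ofReal_mul hc.le] at h
    exact lt_of_mul_lt_mul_left' h
  · rintro s ⟨h0, -⟩
    exact ENNReal.ofReal_le_ofReal (hφ (mul_pos hc h0) h0 (mul_le_of_le_one_left (le_of_lt h0) hc1))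

theorem mul_youngFn_le (hφ : MonotoneOn φ (Ioi 0)) {c : ℝ} (hc1 : 1 ≤ c)
    (x : ℝ≥0∞) : ENNReal.ofReal c * youngFn φ x ≤ youngFn φ (ENNReal.ofReal c * x) := by
  have hc : 0 < c := by linarith
  have h := youngFn_scale hφ (inv_pos.2 hc) (inv_le_one_of_one_le₀ hc1) (ENNReal.ofReal c * x)
  have e : ENNReal.ofReal c⁻¹ = (ENNReal.ofReal c)⁻¹ := ENNReal.ofReal_inv_of_pos hc
  have h0 : ENNReal.ofReal c ≠ 0 := by simpa using hc
  rw [e, ← mul_assoc, ENNReal.inv_mul_cancel h0 ENNReal.ofReal_ne_top, one_mul] at h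
  calc _ ≤ ENNReal.ofReal c * ((ENNReal.ofReal c)⁻¹ * youngFn φ (ENNReal.ofReal c * x)) := by gcongr
    _ = _ := by rw [← mul_assoc, ENNReal.mul_inv_cancel h0 ENNReal.ofReal_ne_top, one_mul]

/-- With `le_youngFn_two_mul`, this lets `Φ(x)` and `x * φ x` be exchanged at the price of doubling
the argument. -/
theorem youngFn_le (hφ : MonotoneOn φ (Ioi 0)) {x : ℝ} (hx : 0 < x) :
    youngFn φ (ENNReal.ofReal x) ≤ ENNReal.ofReal (x * φ x) := by
  rw [youngFn_ofReal]
  calc _ ≤ ∫⁻ s in Ioo 0 x, ENNReal.ofReal (φ x) :=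
        setLIntegral_mono' measurableSet_Ioo fun s hs =>
          ENNReal.ofReal_le_ofReal (hφ hs.1 hx hs.2.le)
    _ = _ := by
      rw [setLIntegral_const, Real.volume_Ioo, sub_zero, mul_comm, ENNReal.ofReal_mul hx.le]

theorem le_setLIntegral_Ioo {h : ℝ → ℝ≥0∞} {a b : ℝ} {m : ℝ≥0∞} (hm : ∀ s ∈ Ioo a b, m ≤ h s) :
    ENNReal.ofReal (b - a) * m ≤ ∫⁻ s in Ioo a b, h s := by
  calc _ = ∫⁻ _ in Ioo a b, m := by rw [setLIntegral_const, Real.volume_Ioo, mul_comm]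
    _ ≤ _ := setLIntegral_mono' measurableSet_Ioo hm

theorem le_youngFn_two_mul (hφ : MonotoneOn φ (Ioi 0)) {x : ℝ} (hx : 0 < x) :
    ENNReal.ofReal (x * φ x) ≤ youngFn φ (ENNReal.ofReal (2 * x)) := by
  rw [youngFn_ofReal, ENNReal.ofReal_mul hx.le]
  calc _ = ENNReal.ofReal (2 * x - x) * ENNReal.ofReal (φ x) := by congr 2; ring
    _ ≤ ∫⁻ s in Ioo x (2 * x), ENNReal.ofReal (φ s) := le_setLIntegral_Ioo fun s hs =>
      ENNReal.ofReal_le_ofReal (hφ hx (hx.trans hs.1) hs.1.le)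
    _ ≤ _ := lintegral_mono_set (Ioo_subset_Ioo_left hx.le)

theorem IsYoungDensity.nonneg (hφ : IsYoungDensity φ) {t : ℝ} (ht : 0 < t) : 0 ≤ φ t := by
  refine le_of_tendsto hφ.tendsto_zero ?_
  filter_upwards [Ioo_mem_nhdsGT ht] with s hs using hφ.monotoneOn hs.1 ht hs.2.le

theorem IsYoungDensity.exists_lt (hφ : IsYoungDensity φ) (s : ℝ) : ∃ t, 0 < t ∧ s < φ t :=
  ((eventually_gt_atTop 0).and (hφ.tendsto_atTop.eventually_gt_atTop s)).exists

theorem IsYoungDensity.youngFn_top (hφ : IsYoungDensity φ) : youngFn φ ∞ = ∞ := by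
  obtain ⟨t, ht, h1⟩ := hφ.exists_lt 1
  have h : (1 : ℝ≥0∞) ≤ youngFn φ (ENNReal.ofReal (t + 1)) := by
    rw [youngFn_ofReal]
    refine le_trans ?_ (lintegral_mono_set (Ioo_subset_Ioo_left ht.le))
    refine le_trans ?_ (le_setLIntegral_Ioo (m := 1) fun s hs => ?_)
    · simp
    · rw [ENNReal.one_le_ofReal]
      exact h1.le.trans (hφ.monotoneOn ht (ht.trans hs.1) hs.1.le)
  refine ENNReal.eq_top_of_forall_nnreal_le fun r => ?_
  have hr : (1 : ℝ) ≤ r + 1 := by simp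
  calc (r : ℝ≥0∞) ≤ ENNReal.ofReal (r + 1) * youngFn φ (ENNReal.ofReal (t + 1)) := by
        refine le_trans ?_ (mul_le_mul_right h _)
        rw [mul_one, ← ENNReal.ofReal_coe_nnreal]
        exact ENNReal.ofReal_le_ofReal (by linarith)
    _ ≤ _ := mul_youngFn_le hφ.monotoneOn hr _
    _ ≤ _ := youngFn_mono φ le_top

end Young

/-! ### The modular and its norm. -/

section Modular

variable {φ : ℝ → ℝ} {γ : ℝ}

theorem modular_mono_ae {g h : ℝ → ℝ≥0∞} (H : ∀ᵐ x, g x ≤ h x) :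
    modular φ γ g ≤ modular φ γ h :=
  lintegral_mono_ae (H.mono fun _ hx => mul_le_mul_left (youngFn_mono φ hx) _)

theorem modular_mono {g h : ℝ → ℝ≥0∞} (H : ∀ x, g x ≤ h x) :
    modular φ γ g ≤ modular φ γ h := modular_mono_ae (Eventually.of_forall H)

theorem measurable_weight (γ : ℝ) : Measurable fun x : ℝ => ENNReal.ofReal (|x| ^ γ) := by
  fun_prop

theorem modular_scale (hφ : MonotoneOn φ (Ioi 0)) {c : ℝ} (hc : 0 < c) (hc1 : c ≤ 1)
    (g : ℝ → ℝ≥0∞) :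
    modular φ γ (fun x => ENNReal.ofReal c * g x) ≤ ENNReal.ofReal c * modular φ γ g := by
  rw [modular, modular, ← lintegral_const_mul' _ _ ENNReal.ofReal_ne_top]
  refine lintegral_mono fun x => ?_
  rw [← mul_assoc]
  exact mul_le_mul_left (youngFn_scale hφ hc hc1 _) _

theorem mul_modular_le (hφ : MonotoneOn φ (Ioi 0)) {c : ℝ} (hc1 : 1 ≤ c)
    (g : ℝ → ℝ≥0∞) :
    ENNReal.ofReal c * modular φ γ g ≤ modular φ γ (fun x => ENNReal.ofReal c * g x) := by
  rw [modular, modular, ← lintegral_const_mul' _ _ ENNReal.ofReal_ne_top]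
  refine lintegral_mono fun x => ?_
  rw [← mul_assoc]
  exact mul_le_mul_left (mul_youngFn_le hφ hc1 _) _

theorem modular_iSup_le {g : ℕ → ℝ → ℝ≥0∞} (hg : ∀ n, AEMeasurable (g n)) :
    modular φ γ (fun x => ⨆ n, g n x) ≤ ∑' n, modular φ γ (g n) := by
  have hm : ∀ n, AEMeasurable (fun x => youngFn φ (g n x) * ENNReal.ofReal (|x| ^ γ)) := fun n =>
    ((measurable_youngFn φ).comp_aemeasurable (hg n)).mul (measurable_weight γ).aemeasurable
  unfold modular
  rw [← lintegral_tsum hm]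
  refine lintegral_mono fun x => ?_
  rw [ENNReal.tsum_mul_right]
  exact mul_le_mul_left (youngFn_iSup_le φ _) _

theorem IsYoungDensity.ae_ne_top (hφ : IsYoungDensity φ) {g : ℝ → ℝ≥0∞} (hg : AEMeasurable g)
    (h : modular φ γ g ≠ ∞) : ∀ᵐ x, g x ≠ ∞ := by
  have h1 := ae_lt_top' (((measurable_youngFn φ).comp_aemeasurable hg).mul
    (measurable_weight γ).aemeasurable) h
  filter_upwards [h1, Measure.ae_ne volume (0 : ℝ)] with x hx hx0 htop
  have hw : ENNReal.ofReal (|x| ^ γ) ≠ 0 := by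
    simpa using Real.rpow_pos_of_pos (abs_pos.2 hx0) γ
  simp [htop, hφ.youngFn_top, ENNReal.top_mul hw] at hx

/-- The weight has degree `γ` and Lebesgue measure degree one. For `γ > -1` every positive factor is
thus realized by a dilation. -/
theorem modular_dilate {ρ : ℝ} (hρ : 0 < ρ) (γ : ℝ) (g : ℝ → ℝ≥0∞) :
    ENNReal.ofReal (ρ ^ (γ + 1)) * modular φ γ (fun x => g (ρ * x)) = modular φ γ g := by
  unfold modular
  rw [← lintegral_comp_mul_left hρ (fun x => youngFn φ (g x) * ENNReal.ofReal (|x| ^ γ)),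
    Real.rpow_add_one hρ.ne', mul_comm (ρ ^ γ), ENNReal.ofReal_mul hρ.le, mul_assoc,
    ← lintegral_const_mul' _ _ ENNReal.ofReal_ne_top]
  congr 1
  refine lintegral_congr fun x => ?_
  rw [abs_mul, abs_of_pos hρ, Real.mul_rpow hρ.le (abs_nonneg x),
    ENNReal.ofReal_mul (Real.rpow_nonneg hρ.le _)]
  ring

theorem luxNorm_mono_ae {g h : ℝ → ℝ≥0∞} (H : ∀ᵐ x, g x ≤ h x) :
    luxNorm φ γ g ≤ luxNorm φ γ h :=
  sInf_le_sInf fun _ hc => ⟨hc.1, hc.2.1,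
    (modular_mono_ae (H.mono fun _ hx => ENNReal.div_le_div_right hx _)).trans hc.2.2⟩

theorem luxNorm_le {g : ℝ → ℝ≥0∞} {c : ℝ≥0∞} (h0 : 0 < c) (ht : c ≠ ∞)
    (h : modular φ γ (fun x => g x / c) ≤ 1) : luxNorm φ γ g ≤ c := sInf_le ⟨h0, ht, h⟩

theorem exists_of_luxNorm_lt {g : ℝ → ℝ≥0∞} {c : ℝ≥0∞} (h : luxNorm φ γ g < c) :
    ∃ d, 0 < d ∧ d ≠ ∞ ∧ d < c ∧ modular φ γ (fun x => g x / d) ≤ 1 := by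
  obtain ⟨d, ⟨h0, ht, hd⟩, hlt⟩ := sInf_lt_iff.1 h
  exact ⟨d, h0, ht, hlt, hd⟩

end Modular

/-! ### The maximal function: sublinearity, dilation, measurability. -/

theorem le_maximalFn (f : ℝ → ℝ) {a b x : ℝ} (hab : a < b) (hx : x ∈ Icc a b) :
    (∫⁻ y in Icc a b, ENNReal.ofReal |f y|) / ENNReal.ofReal (b - a) ≤ maximalFn f x :=
  le_iSup_of_le a <| le_iSup_of_le b <| le_iSup_of_le hab <| le_iSup_of_le hx le_rfl

theorem maximalFn_le {f : ℝ → ℝ} {x : ℝ} {m : ℝ≥0∞}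
    (h : ∀ a b, a < b → x ∈ Icc a b →
      (∫⁻ y in Icc a b, ENNReal.ofReal |f y|) / ENNReal.ofReal (b - a) ≤ m) :
    maximalFn f x ≤ m :=
  iSup_le fun a => iSup_le fun b => iSup_le fun hab => iSup_le fun hx => h a b hab hx

theorem lt_maximalFn_iff {f : ℝ → ℝ} {x : ℝ} {m : ℝ≥0∞} :
    m < maximalFn f x ↔ ∃ a b, a < b ∧ x ∈ Icc a b ∧
      m < (∫⁻ y in Icc a b, ENNReal.ofReal |f y|) / ENNReal.ofReal (b - a) := by
  simp only [maximalFn, lt_iSup_iff, exists_prop]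

theorem maximalFn_mono_ae {f g : ℝ → ℝ} (h : ∀ᵐ x, |f x| ≤ |g x|) (x : ℝ) :
    maximalFn f x ≤ maximalFn g x :=
  maximalFn_le fun _ _ hab hx => (ENNReal.div_le_div_right (lintegral_mono_ae
    (ae_restrict_of_ae (h.mono fun _ hy => ENNReal.ofReal_le_ofReal hy))) _).trans
    (le_maximalFn g hab hx)

theorem maximalFn_congr_ae {f g : ℝ → ℝ} (h : f =ᵐ[volume] g) : maximalFn f = maximalFn g :=
  funext fun x => le_antisymm (maximalFn_mono_ae (h.mono fun y hy => by rw [hy]) x)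
    (maximalFn_mono_ae (h.mono fun y hy => by rw [hy]) x)

theorem maximalFn_add_le {f g : ℝ → ℝ} (hg : AEMeasurable g) (x : ℝ) :
    maximalFn f x ≤ maximalFn g x + maximalFn (fun y => f y - g y) x := by
  refine maximalFn_le fun a b hab hx => ?_
  refine le_trans ?_ (add_le_add (le_maximalFn _ hab hx) (le_maximalFn _ hab hx))
  rw [← ENNReal.add_div, ← lintegral_add_left' (by fun_prop)]
  refine ENNReal.div_le_div_right (lintegral_mono fun y => ?_) _
  rw [← ENNReal.ofReal_add (abs_nonneg _) (abs_nonneg _)]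
  refine ENNReal.ofReal_le_ofReal ?_
  calc |f y| = |g y + (f y - g y)| := by ring_nf
    _ ≤ _ := abs_add_le _ _

theorem maximalFn_const_mul {c : ℝ} (hc : 0 ≤ c) (f : ℝ → ℝ) (x : ℝ) :
    maximalFn (fun y => c * f y) x = ENNReal.ofReal c * maximalFn f x := by
  simp only [maximalFn, ENNReal.mul_iSup, abs_mul, abs_of_nonneg hc, ENNReal.ofReal_mul hc]
  refine iSup_congr fun a => iSup_congr fun b => iSup_congr fun _ => iSup_congr fun _ => ?_
  rw [lintegral_const_mul' _ _ ENNReal.ofReal_ne_top, mul_div_assoc]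

theorem maximalFn_dilate {ρ : ℝ} (hρ : 0 < ρ) (f : ℝ → ℝ) (x : ℝ) :
    maximalFn f (ρ * x) ≤ maximalFn (fun y => f (ρ * y)) x := by
  refine maximalFn_le fun a b hab hx => ?_
  refine le_trans (le_of_eq ?_) (le_maximalFn _ (div_lt_div_of_pos_right hab hρ)
    ⟨(div_le_iff₀' hρ).2 hx.1, (le_div_iff₀' hρ).2 hx.2⟩)
  rw [← setLIntegral_comp_mul_left hρ measurableSet_Icc]
  have h : (fun y => ρ * y) ⁻¹' Icc a b = Icc (a / ρ) (b / ρ) := by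
    ext y; simp [div_le_iff₀' hρ, le_div_iff₀' hρ]
  have e : b - a = ρ * (b / ρ - a / ρ) := by field_simp
  rw [h, e, ENNReal.ofReal_mul hρ.le, ENNReal.mul_div_mul_left _ _ (by simpa) ENNReal.ofReal_ne_top]

/-- If an average exceeds `m` strictly, so does the average over a slightly longer interval, which
contains `x` in its interior. -/
theorem isOpen_lt_maximalFn (f : ℝ → ℝ) (m : ℝ≥0∞) : IsOpen {x | m < maximalFn f x} := by
  refine isOpen_iff_mem_nhds.2 fun x hx => ?_
  obtain ⟨a, b, hab, hxab, h⟩ := lt_maximalFn_iff.1 hx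
  have hcont : Tendsto (fun ε : ℝ => (∫⁻ y in Icc a b, ENNReal.ofReal |f y|) /
      ENNReal.ofReal ((b + ε) - (a - ε))) (𝓝[>] 0)
      (𝓝 ((∫⁻ y in Icc a b, ENNReal.ofReal |f y|) / ENNReal.ofReal (b - a))) := by
    refine ENNReal.Tendsto.const_div (tendsto_nhdsWithin_of_tendsto_nhds ?_)
      (Or.inl ENNReal.ofReal_ne_top)
    have : Continuous fun ε : ℝ => ENNReal.ofReal ((b + ε) - (a - ε)) :=
      ENNReal.continuous_ofReal.comp (by fun_prop)
    simpa using this.tendsto 0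
  obtain ⟨ε, hε, hε0⟩ := ((hcont.eventually_const_lt h).and self_mem_nhdsWithin).exists
  have hε0 : (0 : ℝ) < ε := hε0
  refine mem_of_superset (Ioo_mem_nhds (show a - ε < x by linarith [hxab.1])
    (show x < b + ε by linarith [hxab.2])) fun z hz => ?_
  refine lt_of_lt_of_le hε (le_trans ?_ (le_maximalFn f (by linarith) (Ioo_subset_Icc_self hz)))
  exact ENNReal.div_le_div_right (lintegral_mono_set (Icc_subset_Icc (by linarith) (by linarith))) _

theorem measurable_maximalFn (f : ℝ → ℝ) : Measurable (maximalFn f) :=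
  measurable_of_Ioi fun m => (isOpen_lt_maximalFn f m).measurableSet

/-! ### Equivalence of the boundedness properties of `M`. -/

/-- The norm inequality for the maximal function. -/
def NormBounded (φ : ℝ → ℝ) (γ : ℝ) : Prop :=
  ∃ L : ℝ, 0 < L ∧ ∀ f : ℝ → ℝ, AEMeasurable f volume →
    luxNorm φ γ (maximalFn f) ≤ ENNReal.ofReal L * luxNorm φ γ (fun x => ENNReal.ofReal |f x|)

/-- The modular inequality for the maximal function. -/
def ModularBounded (φ : ℝ → ℝ) (γ : ℝ) : Prop :=
  ∃ K : ℝ, 0 < K ∧ ∀ f : ℝ → ℝ, AEMeasurable f volume →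
    modular φ γ (maximalFn f) ≤ modular φ γ (fun x => ENNReal.ofReal (K * |f x|))

/-- The maximal function is bounded in norm on the unit ball of the modular. -/
def BoundedOnUnitBall (φ : ℝ → ℝ) (γ : ℝ) : Prop :=
  ∃ L : ℝ, 0 < L ∧ ∀ f : ℝ → ℝ, AEMeasurable f volume →
    modular φ γ (fun x => ENNReal.ofReal |f x|) ≤ 1 →
      luxNorm φ γ (maximalFn f) ≤ ENNReal.ofReal L

variable {φ : ℝ → ℝ} {γ : ℝ}

/-- If the modular of `2 * L * f` lies below `r`, the dilation with `ρ ^ (γ + 1) = r` brings it to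
at most one; the norm bound applies there and is dilated back. -/
theorem BoundedOnUnitBall.modularBounded (h : BoundedOnUnitBall φ γ) (hγ : -1 < γ) :
    ModularBounded φ γ := by
  obtain ⟨L, hL, h⟩ := h
  have hK : 0 < 2 * L := by linarith
  -- A strictly larger `r` is positive even when the modular vanishes, so it can be a dilation
  -- factor.
  refine ⟨2 * L, hK, fun f hf => le_of_forall_gt_imp_ge_of_dense fun r hr => ?_⟩
  rcases eq_or_ne r ∞ with rfl | hrt
  · exact le_top
  have hr0 : 0 < r.toReal := ENNReal.toReal_pos (zero_le.trans_lt hr).ne' hrt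
  set ρ : ℝ := r.toReal ^ (γ + 1)⁻¹ with hρdef
  have hρ : 0 < ρ := Real.rpow_pos_of_pos hr0 _
  have hρr : ENNReal.ofReal (ρ ^ (γ + 1)) = r := by
    rw [hρdef, ← Real.rpow_mul hr0.le, inv_mul_cancel₀ (by linarith), Real.rpow_one,
      ENNReal.ofReal_toReal hrt]
  have hr1 : r ≠ 0 := (zero_le.trans_lt hr).ne'
  have hone : ∀ g : ℝ → ℝ≥0∞, modular φ γ g ≤ r ↔ modular φ γ (fun x => g (ρ * x)) ≤ 1 := by
    intro g
    rw [← modular_dilate hρ, hρr]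
    conv_lhs => rw [← mul_one r, mul_assoc, one_mul]
    exact ENNReal.mul_le_mul_iff_right hr1 hrt
  set F : ℝ → ℝ := fun x => (2 * L) * f (ρ * x) with hF
  have hfρ : AEMeasurable (fun x => f (ρ * x)) volume := by
    refine hf.comp_quasiMeasurePreserving ⟨by fun_prop, ?_⟩
    rw [Real.map_volume_mul_left hρ.ne']
    exact Measure.smul_absolutelyContinuous
  have h1 := (hone _).1 hr.le
  have h2 := h F (hfρ.const_mul _) (by simpa [hF, abs_mul, abs_of_pos hL] using h1)
  -- The factor two in `2 * L` leaves room for an admissible `d`, so that attainment of the infimum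
  -- in the norm is not needed.
  obtain ⟨d, hd0, hdt, hdlt, hd⟩ := exists_of_luxNorm_lt
    (h2.trans_lt (show ENNReal.ofReal L < ENNReal.ofReal (2 * L) from
      (ENNReal.ofReal_lt_ofReal_iff hK).2 (by linarith)))
  rw [hone]
  refine le_trans (modular_mono fun x => (maximalFn_dilate hρ f x).trans ?_) hd
  rw [hF, maximalFn_const_mul hK.le, ENNReal.le_div_iff_mul_le (Or.inl hd0.ne') (Or.inl hdt), mul_comm]
  exact mul_le_mul_left hdlt.le _

theorem ModularBounded.normBounded (h : ModularBounded φ γ) : NormBounded φ γ := by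
  obtain ⟨K, hK, h⟩ := h
  refine ⟨K, hK, fun f hf => ?_⟩
  have hK0 : ENNReal.ofReal K ≠ 0 := by simpa using hK
  rw [mul_comm, ← ENNReal.div_le_iff hK0 ENNReal.ofReal_ne_top]
  refine le_sInf fun c ⟨hc0, hct, hc⟩ => ?_
  rw [ENNReal.div_le_iff hK0 ENNReal.ofReal_ne_top]
  have hc' : 0 < c.toReal := ENNReal.toReal_pos hc0.ne' hct
  refine luxNorm_le (by positivity) (ENNReal.mul_ne_top hct ENNReal.ofReal_ne_top) ?_
  have hinv : 0 ≤ (c.toReal * K)⁻¹ := by positivity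
  have e : ENNReal.ofReal (c.toReal * K)⁻¹ = (c * ENNReal.ofReal K)⁻¹ := by
    rw [ENNReal.ofReal_inv_of_pos (by positivity), ENNReal.ofReal_mul hc'.le, ENNReal.ofReal_toReal hct]
  have h1 := h (fun x => (c.toReal * K)⁻¹ * f x) (hf.const_mul _)
  rw [funext fun x => maximalFn_const_mul hinv f x, e] at h1
  refine le_trans (le_of_eq ?_) (h1.trans ((modular_mono fun x => le_of_eq ?_).trans hc))
  · simp only [ENNReal.div_eq_inv_mul]
  · rw [abs_mul, abs_of_nonneg hinv, ENNReal.div_eq_inv_mul]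
    have : K * ((c.toReal * K)⁻¹ * |f x|) = c.toReal⁻¹ * |f x| := by field_simp
    rw [this, ENNReal.ofReal_mul (by positivity), ENNReal.ofReal_inv_of_pos hc',
      ENNReal.ofReal_toReal hct]

theorem luxNorm_lt_top_of_mem (hφ : IsYoungDensity φ) {f : ℝ → ℝ} (hf : f ∈ orliczClass φ γ) :
    luxNorm φ γ (fun x => ENNReal.ofReal |f x|) < ∞ := by
  obtain ⟨-, k, hk, h⟩ := hf
  set m := modular φ γ (fun x => ENNReal.ofReal (k * |f x|)) with hm
  -- Multiplying the argument by `ε ≤ 1` multiplies the modular by at most `ε`, which brings `m`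
  -- below one.
  set ε : ℝ := (m.toReal + 1)⁻¹ with hε
  have hpos : 0 < m.toReal + 1 := by positivity
  have hε0 : 0 < ε := inv_pos.2 hpos
  have hε1 : ε ≤ 1 := inv_le_one_of_one_le₀ (by simp)
  have h1 := modular_scale (γ := γ) hφ.monotoneOn hε0 hε1 (fun x => ENNReal.ofReal (k * |f x|))
  have h2 : ENNReal.ofReal ε * m ≤ 1 := by
    rw [← ENNReal.ofReal_toReal h.ne, ← ENNReal.ofReal_mul hε0.le, ENNReal.ofReal_le_one, hε,
      inv_mul_le_iff₀ hpos]
    linarith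
  have hεk : 0 < (ε * k)⁻¹ := by positivity
  refine (luxNorm_le (c := ENNReal.ofReal (ε * k)⁻¹) (by simpa using hεk) ENNReal.ofReal_ne_top
    ((modular_mono fun x => le_of_eq ?_).trans (h1.trans h2))).trans_lt ENNReal.ofReal_lt_top
  rw [← ENNReal.ofReal_div_of_pos hεk, ← ENNReal.ofReal_mul hε0.le]
  congr 1
  field_simp

theorem luxNorm_toReal_eq {g : ℝ → ℝ≥0∞} (h : ∀ᵐ x, g x ≠ ∞) :
    luxNorm φ γ (fun x => ENNReal.ofReal |(g x).toReal|) = luxNorm φ γ g := by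
  have : ∀ᵐ x, ENNReal.ofReal |(g x).toReal| = g x := h.mono fun x hx => by
    rw [abs_of_nonneg ENNReal.toReal_nonneg, ENNReal.ofReal_toReal hx]
  exact le_antisymm (luxNorm_mono_ae (this.mono fun _ h => h.le))
    (luxNorm_mono_ae (this.mono fun _ h => h.ge))

theorem ae_ne_top_and_mem_of_luxNorm_lt_top (hφ : IsYoungDensity φ) {g : ℝ → ℝ≥0∞}
    (hg : AEMeasurable g) (h : luxNorm φ γ g < ∞) :
    (∀ᵐ x, g x ≠ ∞) ∧ (fun x => (g x).toReal) ∈ orliczClass φ γ := by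
  obtain ⟨d, hd0, hdt, -, hd⟩ := exists_of_luxNorm_lt h
  have hd' : 0 < d.toReal := ENNReal.toReal_pos hd0.ne' hdt
  refine ⟨?_, hg.ennreal_toReal, d.toReal⁻¹, inv_pos.2 hd', ?_⟩
  · filter_upwards [hφ.ae_ne_top (hg.div_const d) (hd.trans_lt ENNReal.one_lt_top).ne] with x hx htop
    exact hx (by rw [htop, ENNReal.top_div_of_ne_top hdt])
  · refine lt_of_le_of_lt (modular_mono fun x => ?_) (hd.trans_lt ENNReal.one_lt_top)
    rw [abs_of_nonneg ENNReal.toReal_nonneg, ENNReal.ofReal_mul (by positivity),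
      ENNReal.ofReal_inv_of_pos hd', ENNReal.ofReal_toReal hdt, ENNReal.div_eq_inv_mul]
    exact mul_le_mul_right ENNReal.ofReal_toReal_le _

theorem NormBounded.mapsClass (hφ : IsYoungDensity φ) (h : NormBounded φ γ) : MapsClass φ γ := by
  obtain ⟨L, -, h⟩ := h
  intro f hf
  exact ae_ne_top_and_mem_of_luxNorm_lt_top hφ (measurable_maximalFn f).aemeasurable
    ((h f hf.1).trans_lt (ENNReal.mul_lt_top ENNReal.ofReal_lt_top (luxNorm_lt_top_of_mem hφ hf)))

theorem NormBounded.continuousOnClass (hφ : IsYoungDensity φ) (h : NormBounded φ γ) :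
    ContinuousOnClass φ γ := by
  have hmap := h.mapsClass hφ
  obtain ⟨L, hL, h⟩ := h
  have hL0 : ENNReal.ofReal L ≠ 0 := by simpa using hL
  intro f hf ε hε
  refine ⟨ε / ENNReal.ofReal L, ENNReal.div_pos hε.ne' ENNReal.ofReal_ne_top, fun g hg hlt => ?_⟩
  refine lt_of_le_of_lt ((luxNorm_mono_ae ?_).trans (h (fun x => f x - g x) (hf.1.sub hg.1))) ?_
  -- Sublinearity gives `|Mf - Mg| ≤ M(f - g)` wherever `Mf` and `Mg` are finite.
  · filter_upwards [(hmap f hf).1, (hmap g hg).1] with x hfx hgx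
    rcases eq_or_ne (maximalFn (fun y => f y - g y) x) ∞ with ht | ht
    · rw [ht]; exact le_top
    have h1 := maximalFn_add_le (f := f) hg.1 x
    have h2 := maximalFn_add_le (f := g) hf.1 x
    have e : maximalFn (fun y => g y - f y) x = maximalFn (fun y => f y - g y) x :=
      le_antisymm (maximalFn_mono_ae (Eventually.of_forall fun y => (abs_sub_comm _ _).le) x)
        (maximalFn_mono_ae (Eventually.of_forall fun y => (abs_sub_comm _ _).le) x)
    rw [e] at h2
    have h1' := ENNReal.toReal_mono (ENNReal.add_ne_top.2 ⟨hgx, ht⟩) h1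
    have h2' := ENNReal.toReal_mono (ENNReal.add_ne_top.2 ⟨hfx, ht⟩) h2
    rw [ENNReal.toReal_add hgx ht] at h1'
    rw [ENNReal.toReal_add hfx ht] at h2'
    rw [ENNReal.ofReal_le_iff_le_toReal ht, abs_le]
    constructor <;> linarith
  · calc _ < ENNReal.ofReal L * (ε / ENNReal.ofReal L) :=
          ENNReal.mul_lt_mul_right hL0 ENNReal.ofReal_ne_top hlt
      _ = ε := ENNReal.mul_div_cancel hL0 ENNReal.ofReal_ne_top

theorem luxNorm_const_mul_le {c : ℝ≥0∞} (hc0 : c ≠ 0) (hct : c ≠ ∞) (g : ℝ → ℝ≥0∞) :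
    c * luxNorm φ γ g ≤ luxNorm φ γ (fun x => c * g x) := by
  refine le_sInf fun d ⟨hd0, hdt, hd⟩ => ?_
  rw [mul_comm, ← ENNReal.le_div_iff_mul_le (Or.inl hc0) (Or.inl hct)]
  refine luxNorm_le (ENNReal.div_pos hd0.ne' hct) (ENNReal.div_ne_top hdt hc0) ?_
  refine (modular_mono fun x => le_of_eq ?_).trans hd
  rw [ENNReal.div_eq_inv_mul, ENNReal.inv_div (Or.inl hct) (Or.inl hc0), ENNReal.div_eq_inv_mul,
    ENNReal.div_eq_inv_mul]
  ring

/-- Otherwise take `f n` in the unit ball with `‖M (f n)‖ > 4 ^ n`. The supremum `G` of the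
functions `2 ^ (-(n + 1)) |f n|` has modular at most `∑ 2 ^ (-(n + 1)) = 1`, yet `‖MG‖ ≥ 2 ^ n / 2`
for all `n`. -/
theorem MapsClass.boundedOnUnitBall (hφ : IsYoungDensity φ) (h : MapsClass φ γ) :
    BoundedOnUnitBall φ γ := by
  by_contra hcon
  have hn : ∀ n : ℕ, ∃ f : ℝ → ℝ, AEMeasurable f volume ∧
      modular φ γ (fun x => ENNReal.ofReal |f x|) ≤ 1 ∧
      ENNReal.ofReal (4 ^ n) < luxNorm φ γ (maximalFn f) := by
    intro n
    by_contra! H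
    exact hcon ⟨4 ^ n, by positivity, H⟩
  choose f hf h1 h4 using hn
  set g : ℕ → ℝ → ℝ≥0∞ := fun n x => ENNReal.ofReal ((1 / 2) ^ (n + 1)) * ENNReal.ofReal |f n x| with hg
  have hgm : ∀ n, AEMeasurable (g n) := fun n => ((hf n).norm.ennreal_ofReal).const_mul _
  set G : ℝ → ℝ≥0∞ := fun x => ⨆ n, g n x with hG
  have hGm : AEMeasurable G := AEMeasurable.iSup hgm
  have hmod : modular φ γ G ≤ 1 := by
    refine (modular_iSup_le hgm).trans ?_
    calc _ ≤ ∑' n : ℕ, ENNReal.ofReal ((1 / 2) ^ (n + 1)) := by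
          refine ENNReal.tsum_le_tsum fun n => (modular_scale hφ.monotoneOn (by positivity)
            (pow_le_one₀ (by norm_num) (by norm_num)) _).trans ?_
          exact (mul_le_mul_right (h1 n) _).trans (mul_one _).le
      _ = 1 := by
          rw [← ENNReal.ofReal_tsum_of_nonneg (fun n => by positivity)
            ((summable_nat_add_iff 1).2 summable_geometric_two)]
          have := tsum_geometric_two' 1
          simp only [pow_succ]
          rw [tsum_mul_right, tsum_geometric_two]
          norm_num
  have hfin := hφ.ae_ne_top hGm (hmod.trans_lt ENNReal.one_lt_top).ne
  have hmem : (fun x => (G x).toReal) ∈ orliczClass φ γ :=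
    (ae_ne_top_and_mem_of_luxNorm_lt_top hφ hGm ((luxNorm_le one_pos ENNReal.one_ne_top
      (by simpa using hmod)).trans_lt ENNReal.one_lt_top)).2
  obtain ⟨hM1, hM2⟩ := h _ hmem
  have hlt := luxNorm_lt_top_of_mem hφ hM2
  rw [luxNorm_toReal_eq hM1] at hlt
  have hbig : ∀ n : ℕ, ENNReal.ofReal (2 ^ n / 2) ≤
      luxNorm φ γ (maximalFn fun x => (G x).toReal) := by
    intro n
    have hpos : (0 : ℝ) < (1 / 2) ^ (n + 1) := by positivity
    calc ENNReal.ofReal (2 ^ n / 2)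
        = ENNReal.ofReal ((1 / 2) ^ (n + 1)) * ENNReal.ofReal (4 ^ n) := by
          rw [← ENNReal.ofReal_mul (by positivity)]
          congr 1
          rw [show (4 : ℝ) = 2 * 2 by norm_num, mul_pow, pow_succ, one_div, inv_pow]
          field_simp
      _ ≤ ENNReal.ofReal ((1 / 2) ^ (n + 1)) * luxNorm φ γ (maximalFn (f n)) := by
          gcongr; exact (h4 n).le
      _ ≤ luxNorm φ γ (fun x => ENNReal.ofReal ((1 / 2) ^ (n + 1)) * maximalFn (f n) x) :=
          luxNorm_const_mul_le (by simp) ENNReal.ofReal_ne_top _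
      _ ≤ _ := by
          refine luxNorm_mono_ae (Eventually.of_forall fun x => ?_)
          rw [← maximalFn_const_mul hpos.le]
          refine maximalFn_mono_ae (hfin.mono fun y hy => ?_) x
          rw [abs_of_nonneg ENNReal.toReal_nonneg, abs_mul, abs_of_pos hpos,
            ← ENNReal.ofReal_le_iff_le_toReal hy, ENNReal.ofReal_mul hpos.le]
          exact le_iSup (fun n => g n y) n
  have hfinal : Tendsto (fun n : ℕ => ENNReal.ofReal (2 ^ n / 2)) atTop (𝓝 ∞) :=
    ENNReal.tendsto_ofReal_atTop.comp
      ((tendsto_pow_atTop_atTop_of_one_lt one_lt_two).atTop_div_const two_pos)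
  exact absurd (le_of_tendsto' hfinal hbig) (not_le.2 hlt)

/-! ### Growth of `φ` against the condition on `Ψ` and the weight. -/

/-- The lower index of `φ` exceeds `σ`. -/
def GrowthCondition (φ : ℝ → ℝ) (σ : ℝ) : Prop :=
  ∃ B : ℝ, 1 < B ∧ ∀ v : ℝ, 0 < v → 2 * B ^ σ * φ v ≤ φ (B * v)

/-- The condition on the complementary function and the weight. -/
def ComplementaryCondition (φ : ℝ → ℝ) (γ : ℝ) : Prop :=
  ∃ C : ℝ, 1 ≤ C ∧
    (∀ t : ℝ, 0 < t →
      complYoungFn φ (ENNReal.ofReal (2 * t)) ≤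
        ENNReal.ofReal C * complYoungFn φ (ENNReal.ofReal t)) ∧
    ((-1 < γ ∧ γ < 0) ∨
      (0 ≤ γ ∧ ∀ t : ℝ, 0 < t →
        (ENNReal.ofReal t)⁻¹ *
            ∫⁻ s in Ioo 0 t, ENNReal.ofReal (densityInv φ (s ^ (-γ))) ≤
          ENNReal.ofReal (C * densityInv φ (C * t ^ (-γ)))))

theorem bddBelow_densityInv (φ : ℝ → ℝ) (s : ℝ) : BddBelow {t : ℝ | 0 < t ∧ s < φ t} :=
  ⟨0, fun _ ht => ht.1.le⟩

theorem densityInv_nonneg (φ : ℝ → ℝ) (s : ℝ) : 0 ≤ densityInv φ s :=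
  Real.sInf_nonneg fun _ ht => ht.1.le

theorem densityInv_le {s t : ℝ} (ht : 0 < t) (h : s < φ t) : densityInv φ s ≤ t :=
  csInf_le (bddBelow_densityInv φ s) ⟨ht, h⟩

theorem IsYoungDensity.lt_of_densityInv_lt (hφ : IsYoungDensity φ) {s t : ℝ}
    (h : densityInv φ s < t) : s < φ t := by
  obtain ⟨u, ⟨hu0, hu⟩, hut⟩ := exists_lt_of_csInf_lt (hφ.exists_lt s) h
  exact hu.trans_le (hφ.monotoneOn hu0 (hu0.trans hut) hut.le)

theorem IsYoungDensity.monotone_densityInv (hφ : IsYoungDensity φ) : Monotone (densityInv φ) :=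
  fun _ s' h => csInf_le_csInf (bddBelow_densityInv φ _) (hφ.exists_lt s')
    fun _ ht => ⟨ht.1, h.trans_lt ht.2⟩

theorem IsYoungDensity.densityInv_mul_le (hφ : IsYoungDensity φ) {l B : ℝ} (hl : 0 < l) (hB : 0 < B)
    (h : ∀ t, 0 < t → l * φ t ≤ φ (B * t)) (s : ℝ) :
    densityInv φ (l * s) ≤ B * densityInv φ s := by
  rw [← div_le_iff₀' hB]
  refine le_csInf (hφ.exists_lt s) fun t ⟨ht0, ht⟩ => (div_le_iff₀' hB).2 ?_
  exact densityInv_le (mul_pos hB ht0) ((mul_lt_mul_of_pos_left ht hl).trans_le (h t ht0))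

/-- Converse of `densityInv_mul_le`. The strict gap `D < B` absorbs the ambiguity of the inverse at
jumps and flat pieces: a level `s` strictly between `φ (B * t) / l` and `φ t` would give `φ⁻¹(l s) ≤
D t < B t`, hence `l s < φ (B t)`. -/
theorem IsYoungDensity.mul_le_of_densityInv (hφ : IsYoungDensity φ) {l D B : ℝ} (hl : 0 < l)
    (hD : 0 ≤ D) (hDB : D < B) (h : ∀ s, 0 < s → densityInv φ (l * s) ≤ D * densityInv φ s)
    {t : ℝ} (ht : 0 < t) : l * φ t ≤ φ (B * t) := by
  by_contra! hcon
  have hBt : 0 < B * t := mul_pos (hD.trans_lt hDB) ht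
  have h1 : φ (B * t) / l < φ t := (div_lt_iff₀' hl).2 hcon
  obtain ⟨s, hs1, hs2⟩ := exists_between h1
  have hs0 : 0 < s := (div_nonneg (hφ.nonneg hBt) hl.le).trans_lt hs1
  have h2 : densityInv φ (l * s) < B * t := by
    calc _ ≤ D * densityInv φ s := h s hs0
      _ ≤ D * t := mul_le_mul_of_nonneg_left (densityInv_le ht hs2) hD
      _ < B * t := mul_lt_mul_of_pos_right hDB ht
  have h3 := hφ.lt_of_densityInv_lt h2
  have h4 := (div_lt_iff₀' hl).1 hs1
  linarith

theorem complYoungFn_two_mul_le {B : ℝ} (hB : 0 ≤ B)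
    (h : ∀ s, densityInv φ (2 * s) ≤ B * densityInv φ s) (t : ℝ) :
    complYoungFn φ (ENNReal.ofReal (2 * t)) ≤
      ENNReal.ofReal (2 * B) * complYoungFn φ (ENNReal.ofReal t) := by
  rw [complYoungFn, complYoungFn, youngFn_ofReal, youngFn_ofReal,
    ← setLIntegral_comp_mul_left two_pos measurableSet_Ioo, ENNReal.ofReal_mul two_pos.le, mul_assoc]
  have hpre : (fun x : ℝ => 2 * x) ⁻¹' Ioo 0 (2 * t) = Ioo 0 t := by ext x; simp
  rw [hpre]
  refine mul_le_mul_right ?_ _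
  rw [← lintegral_const_mul' _ _ ENNReal.ofReal_ne_top]
  refine lintegral_mono fun s => ?_
  rw [← ENNReal.ofReal_mul hB]
  exact ENNReal.ofReal_le_ofReal (h s)

/-- Doubling is used twice: `2v φ⁻¹(2v) ≤ Ψ(4v) ≤ C² Ψ(v) ≤ C² v φ⁻¹(v)`. -/
theorem IsYoungDensity.densityInv_two_mul_le (hφ : IsYoungDensity φ) {C : ℝ} (hC : 1 ≤ C)
    (h : ∀ t : ℝ, 0 < t → complYoungFn φ (ENNReal.ofReal (2 * t)) ≤
      ENNReal.ofReal C * complYoungFn φ (ENNReal.ofReal t)) {v : ℝ} (hv : 0 < v) :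
    densityInv φ (2 * v) ≤ C ^ 2 * densityInv φ v := by
  have hm : MonotoneOn (densityInv φ) (Ioi 0) := hφ.monotone_densityInv.monotoneOn _
  have h1 : ENNReal.ofReal (2 * v * densityInv φ (2 * v)) ≤
      ENNReal.ofReal (C * (C * (v * densityInv φ v))) := by
    calc _ ≤ complYoungFn φ (ENNReal.ofReal (2 * (2 * v))) := le_youngFn_two_mul hm (by positivity)
      _ ≤ ENNReal.ofReal C * (ENNReal.ofReal C * complYoungFn φ (ENNReal.ofReal v)) :=
        (h _ (by positivity)).trans (mul_le_mul_right (h v hv) _)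
      _ ≤ ENNReal.ofReal C * (ENNReal.ofReal C * ENNReal.ofReal (v * densityInv φ v)) := by
        gcongr; exact youngFn_le hm hv
      _ = _ := by rw [← ENNReal.ofReal_mul (by linarith), ← ENNReal.ofReal_mul (by linarith)]
  have hg := densityInv_nonneg φ v
  have hg2 := densityInv_nonneg φ (2 * v)
  have h2 := (ENNReal.ofReal_le_ofReal_iff (by positivity)).1 h1
  have h3 : v * (2 * densityInv φ (2 * v)) ≤ v * (C ^ 2 * densityInv φ v) := by linarith
  have h4 := le_of_mul_le_mul_left h3 hv
  linarith

/-- Contracting a set by `r` multiplies its integral by at most `q`, so the shells towards `0` sum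
like a geometric series. The final bound is itself the induction invariant, since `q / (1 - q) + 1 =
1 / (1 - q)`; no finiteness of `J` is needed. -/
theorem setLIntegral_le_of_geometric {h : ℝ → ℝ≥0∞} {r q t : ℝ} (hr : 0 < r) (hr1 : r < 1)
    (hq : 0 ≤ q) (hq1 : q < 1) (ht : 0 < t)
    (H : ∀ s ∈ Ioo 0 t, ENNReal.ofReal r * h (r * s) ≤ ENNReal.ofReal q * h s) :
    ∫⁻ s in Ioo 0 t, h s ≤ ENNReal.ofReal (1 - q)⁻¹ * ∫⁻ s in Ico (r * t) t, h s := by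
  set J := ∫⁻ s in Ico (r * t) t, h s with hJ
  have hrn : ∀ n : ℕ, 0 < r ^ n * t := fun n => by positivity
  have hrn1 : ∀ n : ℕ, r ^ n * t ≤ t := fun n =>
    mul_le_of_le_one_left ht.le (pow_le_one₀ hr.le hr1.le)
  have hstep : ∀ n : ℕ, ∫⁻ s in Ico (r ^ n * t) t, h s ≤ ENNReal.ofReal (1 - q)⁻¹ * J := by
    intro n
    induction n with
    | zero => simp
    | succ n ih =>
      have hsplit : Ico (r ^ (n + 1) * t) t ⊆ Ico (r ^ (n + 1) * t) (r * t) ∪ Ico (r * t) t := by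
        intro s hs
        rcases lt_or_ge s (r * t) with h | h
        · exact Or.inl ⟨hs.1, h⟩
        · exact Or.inr ⟨h, hs.2⟩
      have hpre : (fun x : ℝ => r * x) ⁻¹' Ico (r ^ (n + 1) * t) (r * t) = Ico (r ^ n * t) t := by
        ext x
        simp only [mem_preimage, mem_Ico, mul_lt_mul_iff_right₀ hr]
        rw [pow_succ, mul_comm (r ^ n) r, mul_assoc, mul_le_mul_iff_right₀ hr]
      calc _ ≤ (∫⁻ s in Ico (r ^ (n + 1) * t) (r * t), h s) + J :=
            (lintegral_mono_set hsplit).trans (lintegral_union_le _ _ _)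
        _ ≤ ENNReal.ofReal q * (ENNReal.ofReal (1 - q)⁻¹ * J) + J := by
          gcongr
          rw [← setLIntegral_comp_mul_left hr measurableSet_Ico, hpre,
            ← lintegral_const_mul' _ _ ENNReal.ofReal_ne_top]
          refine le_trans (setLIntegral_mono' measurableSet_Ico fun s hs =>
            H s ⟨(hrn n).trans_le hs.1, hs.2⟩) ?_
          rw [lintegral_const_mul' _ _ ENNReal.ofReal_ne_top]
          gcongr
        _ = ENNReal.ofReal (1 - q)⁻¹ * J := by
          have h1q : 0 < 1 - q := by linarith
          conv_lhs => rw [← one_mul J, ← mul_assoc, ← mul_assoc, ← add_mul, mul_one,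
            ← ENNReal.ofReal_mul hq, ← ENNReal.ofReal_one, ← ENNReal.ofReal_add (by positivity) (by simp)]
          congr 2
          field_simp
          ring
  have hU : Ioo 0 t = ⋃ n : ℕ, Ico (r ^ n * t) t := by
    ext s
    simp only [mem_Ioo, mem_iUnion, mem_Ico]
    constructor
    · rintro ⟨h0, h1⟩
      obtain ⟨n, hn⟩ := exists_pow_lt_of_lt_one (div_pos h0 ht) hr1
      exact ⟨n, ((lt_div_iff₀ ht).1 hn).le, h1⟩
    · rintro ⟨n, h0, h1⟩
      exact ⟨(hrn n).trans_le h0, h1⟩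
  have hmono : Monotone fun n : ℕ => Ico (r ^ n * t) t := fun m n hmn =>
    Ico_subset_Ico_left (mul_le_mul_of_nonneg_right (pow_le_pow_of_le_one hr.le hr1.le hmn) ht.le)
  rw [hU, setLIntegral_iUnion_of_directed _ hmono.directed_le]
  exact iSup_le hstep

theorem GrowthCondition.complementaryCondition (hφ : IsYoungDensity φ) (hγ : -1 < γ)
    (h : GrowthCondition φ (max γ 0)) : ComplementaryCondition φ γ := by
  obtain ⟨B, hB, h⟩ := h
  have hB0 : 0 < B := by linarith
  have hBσ : 1 ≤ B ^ max γ 0 := Real.one_le_rpow hB.le (le_max_right _ _)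
  have hinv := hφ.densityInv_mul_le (by positivity) hB0 h
  have hmono := hφ.monotone_densityInv
  have h2 : ∀ s, densityInv φ (2 * s) ≤ B * densityInv φ s := hφ.densityInv_mul_le two_pos hB0
    fun t ht => le_trans (by nlinarith [hφ.nonneg ht]) (h t ht)
  have hΔ := complYoungFn_two_mul_le hB0.le h2
  have hΔ' : ∀ {C : ℝ}, 2 * B ≤ C → ∀ t : ℝ, 0 < t →
      complYoungFn φ (ENNReal.ofReal (2 * t)) ≤
        ENNReal.ofReal C * complYoungFn φ (ENNReal.ofReal t) := fun hC t _ =>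
    (hΔ t).trans (mul_le_mul_left (ENNReal.ofReal_le_ofReal hC) _)
  rcases lt_trichotomy γ 0 with hneg | rfl | hpos
  · exact ⟨2 * B, by linarith, hΔ' le_rfl, Or.inl ⟨hγ, hneg⟩⟩
  · refine ⟨2 * B, by linarith, hΔ' le_rfl, Or.inr ⟨le_rfl, fun t ht => ?_⟩⟩
    have ht' : ENNReal.ofReal t ≠ 0 := by simpa using ht
    simp only [neg_zero, Real.rpow_zero, mul_one]
    rw [setLIntegral_const, Real.volume_Ioo, sub_zero, mul_comm (ENNReal.ofReal _) (ENNReal.ofReal t),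
      ← mul_assoc, ENNReal.inv_mul_cancel ht' ENNReal.ofReal_ne_top, one_mul]
    refine ENNReal.ofReal_le_ofReal ((hmono (show (1 : ℝ) ≤ 2 * B by linarith)).trans ?_)
    exact le_mul_of_one_le_left (densityInv_nonneg _ _) (by linarith)
  · rw [max_eq_left hpos.le] at hinv hBσ
    -- Chosen so that `r ^ (-γ) = 2 * B ^ γ`: growth then gives `h (r * s) ≤ B * h s` for `h s =
    -- φ⁻¹(s^(-γ))`, with geometric ratio `r * B = 2 ^ (-1/γ) < 1`.
    set r : ℝ := (2 * B ^ γ) ^ (-γ⁻¹) with hr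
    have hb1 : 1 < 2 * B ^ γ := by linarith
    have hr0 : 0 < r := by positivity
    have hr1 : r < 1 := Real.rpow_lt_one_of_one_lt_of_neg hb1 (by simpa using hpos)
    have hrγ : r ^ (-γ) = 2 * B ^ γ := by
      rw [hr, ← Real.rpow_mul (by positivity), neg_mul_neg, inv_mul_cancel₀ hpos.ne', Real.rpow_one]
    have hq : r * B = 2 ^ (-γ⁻¹) := by
      rw [hr, Real.mul_rpow two_pos.le (by positivity), ← Real.rpow_mul hB0.le, mul_neg,
        mul_inv_cancel₀ hpos.ne', Real.rpow_neg_one, mul_assoc, inv_mul_cancel₀ hB0.ne', mul_one]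
    have hq1 : r * B < 1 := by
      rw [hq]; exact Real.rpow_lt_one_of_one_lt_of_neg one_lt_two (by simpa using hpos)
    have h1q : 0 < 1 - r * B := by linarith
    set C : ℝ := max (2 * B) ((1 - r * B)⁻¹ * B) with hC
    have hC1 : 1 ≤ C := le_trans (by linarith) (le_max_left _ _)
    have hscale : ∀ s : ℝ, 0 < s →
        densityInv φ ((r * s) ^ (-γ)) ≤ B * densityInv φ (s ^ (-γ)) := fun s hs => by
      rw [Real.mul_rpow hr0.le hs.le, hrγ]
      exact hinv _
    refine ⟨C, hC1, hΔ' (le_max_left _ _), Or.inr ⟨hpos.le, fun t ht => ?_⟩⟩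
    have ht' : ENNReal.ofReal t ≠ 0 := by simpa using ht
    have key : ∫⁻ s in Ioo 0 t, ENNReal.ofReal (densityInv φ (s ^ (-γ))) ≤
        ENNReal.ofReal t * ENNReal.ofReal (C * densityInv φ (C * t ^ (-γ))) := by
      calc _ ≤ ENNReal.ofReal (1 - r * B)⁻¹ *
            ∫⁻ s in Ico (r * t) t, ENNReal.ofReal (densityInv φ (s ^ (-γ))) := by
            refine setLIntegral_le_of_geometric hr0 hr1 (by positivity) hq1 ht fun s hs => ?_
            rw [← ENNReal.ofReal_mul hr0.le, ← ENNReal.ofReal_mul (by positivity), mul_assoc]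
            exact ENNReal.ofReal_le_ofReal (mul_le_mul_of_nonneg_left (hscale s hs.1) hr0.le)
        _ ≤ ENNReal.ofReal (1 - r * B)⁻¹ * ∫⁻ s in Ico (r * t) t,
            ENNReal.ofReal (B * densityInv φ (t ^ (-γ))) := by
            refine mul_le_mul_right (setLIntegral_mono' measurableSet_Ico fun s hs =>
              ENNReal.ofReal_le_ofReal ((hmono ?_).trans (hscale t ht))) _
            exact Real.rpow_le_rpow_of_nonpos (by positivity) hs.1 (by linarith)
        _ ≤ ENNReal.ofReal (1 - r * B)⁻¹ *
            (ENNReal.ofReal (B * densityInv φ (t ^ (-γ))) * ENNReal.ofReal t) := by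
            rw [setLIntegral_const, Real.volume_Ico]
            gcongr
            nlinarith
        _ = ENNReal.ofReal t *
            ENNReal.ofReal ((1 - r * B)⁻¹ * B * densityInv φ (t ^ (-γ))) := by
            rw [← mul_assoc, ← ENNReal.ofReal_mul (by positivity), mul_comm, mul_assoc]
        _ ≤ _ := by
            refine mul_le_mul_right (ENNReal.ofReal_le_ofReal ?_) _
            refine mul_le_mul (le_max_right _ _) (hmono ?_) (densityInv_nonneg _ _) (by linarith)
            exact le_mul_of_one_le_left (by positivity) hC1
    calc _ ≤ (ENNReal.ofReal t)⁻¹ *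
          (ENNReal.ofReal t * ENNReal.ofReal (C * densityInv φ (C * t ^ (-γ)))) := by gcongr
      _ = _ := by rw [← mul_assoc, ENNReal.inv_mul_cancel ht' ENNReal.ofReal_ne_top, one_mul]

/-- For `γ > 0` put `h t = φ⁻¹(t^(-γ))`, which is nonincreasing, and `H t = ∫₀ᵗ h`. Then `t h(t) ≤
H(t) ≤ E t h(t)`, so the half interval `(t/2, t)` carries a fixed fraction of `H(t)`. Hence `H(t/2)
≤ q H(t)` with `q < 1`, and iteration yields decay beating any constant. -/
theorem ComplementaryCondition.growthCondition (hφ : IsYoungDensity φ)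
    (h : ComplementaryCondition φ γ) : GrowthCondition φ (max γ 0) := by
  obtain ⟨C, hC, hΔ, hA⟩ := h
  have hC0 : 0 < C := by linarith
  have hmono := hφ.monotone_densityInv
  have hnn := densityInv_nonneg φ
  have h2 : ∀ v : ℝ, 0 < v → densityInv φ (2 * v) ≤ C ^ 2 * densityInv φ v :=
    fun v hv => hφ.densityInv_two_mul_le hC hΔ hv
  rcases le_or_gt γ 0 with hγ | hγ
  · refine ⟨C ^ 2 + 1, by nlinarith, fun v hv => ?_⟩
    rw [max_eq_right hγ, Real.rpow_zero, mul_one]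
    exact hφ.mul_le_of_densityInv two_pos (by positivity) (by linarith) h2 hv
  rw [max_eq_left hγ.le]
  have hA : ∀ t : ℝ, 0 < t → (ENNReal.ofReal t)⁻¹ *
      ∫⁻ s in Ioo 0 t, ENNReal.ofReal (densityInv φ (s ^ (-γ))) ≤
        ENNReal.ofReal (C * densityInv φ (C * t ^ (-γ))) := by
    rcases hA with hA | hA
    · linarith [hA.2]
    · exact hA.2
  have h2k : ∀ (k : ℕ) (v : ℝ), 0 < v →
      densityInv φ (2 ^ k * v) ≤ (C ^ 2) ^ k * densityInv φ v := by
    intro k v hv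
    induction k with
    | zero => simp
    | succ k ih =>
      calc _ = densityInv φ (2 * (2 ^ k * v)) := by ring_nf
        _ ≤ C ^ 2 * densityInv φ (2 ^ k * v) := h2 _ (by positivity)
        _ ≤ C ^ 2 * ((C ^ 2) ^ k * densityInv φ v) := by gcongr
        _ = _ := by ring
  -- Doubling `k` times absorbs the constant `C` inside `φ⁻¹(C t^(-γ))`.
  obtain ⟨k, hk⟩ := pow_unbounded_of_one_lt C one_lt_two
  set E : ℝ := C * (C ^ 2) ^ k with hE
  have hE1 : 1 ≤ E := one_le_mul_of_one_le_of_one_le hC (one_le_pow₀ (one_le_pow₀ hC))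
  have hE0 : 0 < E := by linarith
  set H : ℝ → ℝ≥0∞ := fun t => ∫⁻ s in Ioo 0 t, ENNReal.ofReal (densityInv φ (s ^ (-γ))) with hH
  set h : ℝ → ℝ := fun t => densityInv φ (t ^ (-γ)) with hh
  have hanti : ∀ {s t : ℝ}, 0 < s → s ≤ t → h t ≤ h s := fun hs hst =>
    hmono (Real.rpow_le_rpow_of_nonpos hs hst (by linarith))
  have hup : ∀ t, 0 < t → H t ≤ ENNReal.ofReal (E * (t * h t)) := by
    intro t ht
    have ht' : ENNReal.ofReal t ≠ 0 := by simpa using ht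
    have htγ : 0 < t ^ (-γ) := by positivity
    have h3 : C * densityInv φ (C * t ^ (-γ)) ≤ E * h t := by
      rw [hE, mul_assoc]
      refine mul_le_mul_of_nonneg_left (le_trans (hmono ?_) (h2k k _ htγ)) hC0.le
      exact mul_le_mul_of_nonneg_right hk.le htγ.le
    calc H t = ENNReal.ofReal t * ((ENNReal.ofReal t)⁻¹ * H t) := by
          rw [← mul_assoc, ENNReal.mul_inv_cancel ht' ENNReal.ofReal_ne_top, one_mul]
      _ ≤ ENNReal.ofReal t * ENNReal.ofReal (E * h t) := by
          gcongr; exact (hA t ht).trans (ENNReal.ofReal_le_ofReal h3)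
      _ = _ := by rw [← ENNReal.ofReal_mul ht.le]; congr 1; ring
  have hfin : ∀ t, 0 < t → H t ≠ ∞ := fun t ht => ((hup t ht).trans_lt ENNReal.ofReal_lt_top).ne
  have hlow : ∀ a t, 0 ≤ a → a < t → ENNReal.ofReal ((t - a) * h t) ≤
      ∫⁻ s in Ioo a t, ENNReal.ofReal (h s) := by
    intro a t ha hat
    rw [ENNReal.ofReal_mul (by linarith)]
    exact le_setLIntegral_Ioo fun s hs =>
      ENNReal.ofReal_le_ofReal (hanti (ha.trans_lt hs.1) hs.2.le)
  have hupR : ∀ t, 0 < t → (H t).toReal ≤ E * (t * h t) := fun t ht =>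
    ENNReal.toReal_le_of_le_ofReal (mul_nonneg hE0.le (mul_nonneg ht.le (hnn _))) (hup t ht)
  have hlowR : ∀ t, 0 < t → t * h t ≤ (H t).toReal := fun t ht => by
    have := hlow 0 t le_rfl ht
    rw [sub_zero] at this
    exact (ENNReal.ofReal_le_iff_le_toReal (hfin t ht)).1 this
  have hhalf : ∀ t, 0 < t → (H (t / 2)).toReal ≤ (1 - 1 / (2 * E)) * (H t).toReal := by
    intro t ht
    have h3 : H (t / 2) + ENNReal.ofReal ((t - t / 2) * h t) ≤ H t := by
      refine (add_le_add le_rfl (hlow (t / 2) t (by linarith) (by linarith))).trans ?_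
      rw [hH, ← lintegral_union measurableSet_Ioo]
      · refine lintegral_mono_set (union_subset (Ioo_subset_Ioo_right (by linarith))
          (Ioo_subset_Ioo_left (by linarith)))
      · rw [Set.disjoint_left]
        intro s hs hs'
        exact absurd hs.2 (not_lt.2 hs'.1.le)
    have h4 := ENNReal.toReal_mono (hfin t ht) h3
    rw [ENNReal.toReal_add (hfin _ (by linarith)) ENNReal.ofReal_ne_top,
      ENNReal.toReal_ofReal (mul_nonneg (by linarith) (hnn _))] at h4
    have h5 : 1 / (2 * E) * (H t).toReal ≤ 1 / (2 * E) * (E * (t * h t)) :=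
      mul_le_mul_of_nonneg_left (hupR t ht) (by positivity)
    have h6 : 1 / (2 * E) * (E * (t * h t)) = (t - t / 2) * h t := by field_simp; ring
    linarith
  set q : ℝ := 1 - 1 / (2 * E) with hq
  have hq1 : q < 1 := by rw [hq]; simpa using hE0
  have hq0 : 0 ≤ q := by
    rw [hq, sub_nonneg, div_le_one (by positivity)]; linarith
  have hiter : ∀ (n : ℕ) (t : ℝ), 0 < t → (H (t / 2 ^ n)).toReal ≤ q ^ n * (H t).toReal := by
    intro n t ht
    induction n with
    | zero => simp
    | succ n ih =>
      calc _ = (H (t / 2 ^ n / 2)).toReal := by rw [div_div, pow_succ]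
        _ ≤ q * (H (t / 2 ^ n)).toReal := hhalf _ (by positivity)
        _ ≤ q * (q ^ n * (H t).toReal) := by gcongr
        _ = _ := by ring
  have hdec : ∀ n : ℕ, ∀ s : ℝ, 0 < s →
      densityInv φ ((2 : ℝ) ^ (n * γ) * s) ≤ 2 ^ n * (E * q ^ n) * densityInv φ s := by
    intro n s hs
    set t : ℝ := s ^ (-γ⁻¹) with htdef
    have ht : 0 < t := by positivity
    have hts : t ^ (-γ) = s := by
      rw [htdef, ← Real.rpow_mul hs.le, neg_mul_neg, inv_mul_cancel₀ hγ.ne', Real.rpow_one]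
    have hts' : (t / 2 ^ n) ^ (-γ) = (2 : ℝ) ^ (n * γ) * s := by
      rw [Real.div_rpow ht.le (by positivity), hts, ← Real.rpow_natCast_mul two_pos.le, mul_neg,
        Real.rpow_neg two_pos.le, div_inv_eq_mul, mul_comm]
    have h3 := ((hlowR (t / 2 ^ n) (by positivity)).trans (hiter n t ht)).trans
      (mul_le_mul_of_nonneg_left (hupR t ht) (pow_nonneg hq0 n))
    simp only [hh] at h3
    rw [hts, hts', div_mul_eq_mul_div, div_le_iff₀ (by positivity)] at h3
    refine le_of_mul_le_mul_left (h3.trans (le_of_eq ?_)) ht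
    ring
  have hlim : Tendsto (fun n : ℕ => E * q ^ n) atTop (𝓝 0) := by
    simpa using (tendsto_pow_atTop_nhds_zero_of_lt_one hq0 hq1).const_mul E
  -- With `B = 2 ^ (n - 1/γ)` one has `2 * B ^ γ = 2 ^ (n γ)`. The first requirement makes the
  -- constant `2 ^ n * (E * q ^ n)` of `hdec` smaller than `B`; the second makes `B > 1`.
  obtain ⟨n, hn1, hn2⟩ := ((hlim.eventually_lt_const
    (show (0 : ℝ) < 2 ^ (-γ⁻¹) by positivity)).and
      (tendsto_natCast_atTop_atTop.eventually_gt_atTop γ⁻¹)).exists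
  refine ⟨2 ^ ((n : ℝ) - γ⁻¹), Real.one_lt_rpow one_lt_two (by linarith), fun v hv => ?_⟩
  have e : 2 * ((2 : ℝ) ^ ((n : ℝ) - γ⁻¹)) ^ γ = 2 ^ (n * γ) := by
    rw [← Real.rpow_mul two_pos.le, sub_mul, inv_mul_cancel₀ hγ.ne', Real.rpow_sub two_pos,
      Real.rpow_one]
    field_simp
  rw [e]
  refine hφ.mul_le_of_densityInv (by positivity) (by positivity) ?_ (hdec n) hv
  rw [sub_eq_add_neg, Real.rpow_add two_pos, Real.rpow_natCast]
  exact mul_lt_mul_of_pos_left hn1 (by positivity)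

/-! ### From the modular inequality to growth of `φ`. -/

theorem le_maximalFn_indicator {a δ u x : ℝ} (hδ : 0 < δ) (hu : 0 < u) {m : ℝ} (hm : 1 ≤ m)
    (hx : x ∈ Icc a (a + m * δ)) :
    ENNReal.ofReal (u / m) ≤ maximalFn ((Icc a (a + δ)).indicator fun _ => u) x := by
  have hm0 : 0 < m := by linarith
  refine le_trans ?_ (le_maximalFn _ (show a < a + m * δ by nlinarith [mul_pos hm0 hδ]) hx)
  have h1 : ENNReal.ofReal (u * δ) ≤ ∫⁻ y in Icc a (a + m * δ),
      ENNReal.ofReal |(Icc a (a + δ)).indicator (fun _ => u) y| := by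
    refine le_trans ?_ (lintegral_mono_set (Icc_subset_Icc_right (show a + δ ≤ a + m * δ by nlinarith)))
    rw [setLIntegral_congr_fun (g := fun _ => ENNReal.ofReal u) measurableSet_Icc fun y hy => by
      simp [indicator_of_mem hy, abs_of_pos hu], setLIntegral_const, Real.volume_Icc,
      ← ENNReal.ofReal_mul hu.le]
    simp
  refine le_trans (le_of_eq ?_) (ENNReal.div_le_div_right h1 _)
  have hmδ : 0 < a + m * δ - a := by simp only [add_sub_cancel_left]; positivity
  rw [← ENNReal.ofReal_div_of_pos hmδ]
  congr 1
  field_simp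
  ring

/-- Test on `u` times the indicator of `[a, a + δ]`: on the `j`-th dyadic shell, of length `2 ^ j *
δ`, the maximal function is at least `u / 2 ^ (j + 1)`. The length `δ` cancels, so the bound is
independent of scale. -/
theorem sum_youngFn_le {K : ℝ}
    (h : ∀ f : ℝ → ℝ, AEMeasurable f volume →
      modular φ γ (maximalFn f) ≤ modular φ γ (fun x => ENNReal.ofReal (K * |f x|)))
    {a δ c σ : ℝ} (hδ : 0 < δ) (_hc : 0 ≤ c) {n : ℕ}
    (hw1 : ∀ x ∈ Icc a (a + δ), |x| ^ γ ≤ 1)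
    (hw2 : ∀ j < n, ∀ x ∈ Ioo (a + 2 ^ j * δ) (a + 2 ^ (j + 1) * δ), c * 2 ^ (j * σ) ≤ |x| ^ γ)
    {u : ℝ} (hu : 0 < u) :
    ∑ j ∈ Finset.range n, ENNReal.ofReal (2 ^ j * (c * 2 ^ (j * σ))) *
      youngFn φ (ENNReal.ofReal (u / 2 ^ (j + 1))) ≤ youngFn φ (ENNReal.ofReal (K * u)) := by
  set f : ℝ → ℝ := (Icc a (a + δ)).indicator fun _ => u with hf
  have hδ0 : ENNReal.ofReal δ ≠ 0 := by simpa using hδ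
  have hright : modular φ γ (fun x => ENNReal.ofReal (K * |f x|)) ≤
      ENNReal.ofReal δ * youngFn φ (ENNReal.ofReal (K * u)) := by
    calc _ = ∫⁻ x, (Icc a (a + δ)).indicator
          (fun x => youngFn φ (ENNReal.ofReal (K * u)) * ENNReal.ofReal (|x| ^ γ)) x := by
          refine lintegral_congr fun x => ?_
          by_cases hx : x ∈ Icc a (a + δ)
          · simp [hf, indicator_of_mem hx, abs_of_pos hu]
          · simp [hf, indicator_of_notMem hx, youngFn_zero]
      _ = ∫⁻ x in Icc a (a + δ), youngFn φ (ENNReal.ofReal (K * u)) * ENNReal.ofReal (|x| ^ γ) :=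
          lintegral_indicator measurableSet_Icc _
      _ ≤ ∫⁻ x in Icc a (a + δ), youngFn φ (ENNReal.ofReal (K * u)) :=
          setLIntegral_mono' measurableSet_Icc fun x hx =>
            (mul_le_mul_right (ENNReal.ofReal_le_one.2 (hw1 x hx)) _).trans (mul_one _).le
      _ = _ := by rw [setLIntegral_const, Real.volume_Icc, add_sub_cancel_left, mul_comm]
  have hleft : ENNReal.ofReal δ * ∑ j ∈ Finset.range n, ENNReal.ofReal (2 ^ j * (c * 2 ^ (j * σ))) *
      youngFn φ (ENNReal.ofReal (u / 2 ^ (j + 1))) ≤ modular φ γ (maximalFn f) := by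
    rw [Finset.mul_sum]
    set I : ℕ → Set ℝ := fun j => Ioo (a + 2 ^ j * δ) (a + 2 ^ (j + 1) * δ) with hI
    calc _ ≤ ∑ j ∈ Finset.range n,
          ∫⁻ x in I j, youngFn φ (maximalFn f x) * ENNReal.ofReal (|x| ^ γ) := by
          refine Finset.sum_le_sum fun j hj => ?_
          have hj' := Finset.mem_range.1 hj
          refine le_trans (le_of_eq ?_) (le_setLIntegral_Ioo
            (m := youngFn φ (ENNReal.ofReal (u / 2 ^ (j + 1))) * ENNReal.ofReal (c * 2 ^ (j * σ)))
            fun x hx => ?_)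
          · rw [show a + 2 ^ (j + 1) * δ - (a + 2 ^ j * δ) = δ * 2 ^ j by ring,
              ENNReal.ofReal_mul hδ.le, ENNReal.ofReal_mul (by positivity)]
            ring
          · refine mul_le_mul' (youngFn_mono φ (le_maximalFn_indicator hδ hu
              (one_le_pow₀ one_le_two) ⟨?_, hx.2.le⟩)) (ENNReal.ofReal_le_ofReal (hw2 j hj' x hx))
            have : 0 < (2 : ℝ) ^ j * δ := by positivity
            linarith [hx.1]
      _ = ∫⁻ x in ⋃ j ∈ Finset.range n, I j, youngFn φ (maximalFn f x) * ENNReal.ofReal (|x| ^ γ) := by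
          rw [lintegral_biUnion_finset _ fun j _ => measurableSet_Ioo]
          have hmono : Monotone fun j : ℕ => a + 2 ^ j * δ := fun i j hij => by
            have : (2 : ℝ) ^ i ≤ 2 ^ j := pow_le_pow_right₀ one_le_two hij
            simp only [add_le_add_iff_left]
            gcongr
          have := hmono.pairwise_disjoint_on_Ioo_succ
          exact fun i _ j _ hij => this hij
      _ ≤ _ := setLIntegral_le_lintegral _ _
  refine (ENNReal.mul_le_mul_iff_right hδ0 ENNReal.ofReal_ne_top).1
    (hleft.trans ((h f ?_).trans hright))
  exact (measurable_const.indicator measurableSet_Icc).aemeasurable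

theorem IsYoungDensity.sum_density_le (hφ : IsYoungDensity φ) {K c σ v : ℝ} {n : ℕ} (hK : 0 < K)
    (hc : 0 < c) (hc1 : c ≤ 1) (hv : 0 < v)
    (h : ∑ j ∈ Finset.range n, ENNReal.ofReal (2 ^ j * (c * 2 ^ (j * σ))) *
      youngFn φ (ENNReal.ofReal (4 * v / 2 ^ (j + 1))) ≤
        youngFn φ (ENNReal.ofReal (K * (4 * v)))) :
    ∑ j ∈ Finset.range n, 2 ^ (j * σ) * φ (v / 2 ^ j) ≤
      (4 * K / c) * φ ((4 * K / c) * v) := by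
  have hnn : ∀ j ∈ Finset.range n, 0 ≤ 2 ^ j * (c * 2 ^ (j * σ)) * (v / 2 ^ j * φ (v / 2 ^ j)) :=
    fun j _ => mul_nonneg (by positivity) (mul_nonneg (by positivity) (hφ.nonneg (by positivity)))
  have h1 : ENNReal.ofReal (∑ j ∈ Finset.range n,
      2 ^ j * (c * 2 ^ (j * σ)) * (v / 2 ^ j * φ (v / 2 ^ j))) ≤
      ENNReal.ofReal (K * (4 * v) * φ (K * (4 * v))) := by
    rw [ENNReal.ofReal_sum_of_nonneg hnn]
    refine (Finset.sum_le_sum fun j _ => ?_).trans (h.trans (youngFn_le hφ.monotoneOn (by positivity)))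
    rw [ENNReal.ofReal_mul (by positivity)]
    -- The height `4 * v` makes the argument `4 * v / 2 ^ (j + 1)` equal to `2 * (v / 2 ^ j)`.
    refine mul_le_mul_right ((le_youngFn_two_mul hφ.monotoneOn (by positivity)).trans (le_of_eq ?_)) _
    congr 2
    rw [pow_succ]
    field_simp
    norm_num
  rw [ENNReal.ofReal_le_ofReal_iff (mul_nonneg (by positivity) (hφ.nonneg (by positivity)))] at h1
  have h2 : φ (K * (4 * v)) ≤ φ ((4 * K / c) * v) := by
    have h0 : 0 < K * (4 * v) := by positivity
    have h1 : 0 < (4 * K / c) * v := by positivity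
    refine hφ.monotoneOn h0 h1 ?_
    rw [div_mul_eq_mul_div, le_div_iff₀ hc]
    nlinarith [mul_pos hK hv]
  have h3 : ∑ j ∈ Finset.range n, 2 ^ j * (c * 2 ^ (j * σ)) * (v / 2 ^ j * φ (v / 2 ^ j)) =
      c * v * ∑ j ∈ Finset.range n, 2 ^ (j * σ) * φ (v / 2 ^ j) := by
    rw [Finset.mul_sum]
    refine Finset.sum_congr rfl fun j _ => ?_
    field_simp
  rw [h3] at h1
  refine le_of_mul_le_mul_left (h1.trans ?_) (mul_pos hc hv)
  calc _ ≤ K * (4 * v) * φ ((4 * K / c) * v) := mul_le_mul_of_nonneg_left h2 (by positivity)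
    _ = _ := by field_simp

/-- For `γ ≥ 0` the test interval is `[0, 1]`, and the weight grows like `2 ^ (j γ)` along the
shells. For `γ < 0` it starts at `1` and has length `2 ^ (-n)`, so all `n` shells stay in `[1, 2]`,
where the weight lies between `2 ^ γ` and `1`. -/
theorem ModularBounded.exists_sum_density_le (hφ : IsYoungDensity φ) (h : ModularBounded φ γ) :
    ∃ K : ℝ, 0 < K ∧ ∀ (n : ℕ) (v : ℝ), 0 < v →
      ∑ j ∈ Finset.range n, 2 ^ (j * max γ 0) * φ (v / 2 ^ j) ≤ K * φ (K * v) := by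
  obtain ⟨K, hK, h⟩ := h
  rcases le_or_gt 0 γ with hγ | hγ
  · refine ⟨4 * K / 1, by positivity, fun n v hv => ?_⟩
    rw [max_eq_left hγ]
    refine hφ.sum_density_le hK one_pos le_rfl hv
      (sum_youngFn_le h (a := 0) (δ := 1) one_pos zero_le_one ?_ ?_ (by positivity))
    · intro x hx
      rw [zero_add] at hx
      exact Real.rpow_le_one (abs_nonneg x) (by rw [abs_of_nonneg hx.1]; exact hx.2) hγ
    · intro j _ x hx
      simp only [zero_add, mul_one] at hx
      rw [one_mul, Real.rpow_natCast_mul two_pos.le]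
      exact Real.rpow_le_rpow (by positivity) (hx.1.le.trans (le_abs_self x)) hγ
  · refine ⟨4 * K / 2 ^ γ, by positivity, fun n v hv => ?_⟩
    rw [max_eq_right hγ.le]
    refine hφ.sum_density_le hK (by positivity)
      (Real.rpow_le_one_of_one_le_of_nonpos one_le_two hγ.le) hv
      (sum_youngFn_le h (a := 1) (δ := (2 ^ n)⁻¹) (by positivity) (by positivity) ?_ ?_
        (by positivity))
    · intro x hx
      exact Real.rpow_le_one_of_one_le_of_nonpos (hx.1.trans (le_abs_self x)) hγ.le
    · intro j hj x hx
      have hx1 : 1 < x := lt_of_le_of_lt (by simp) hx.1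
      have hx2 : x ≤ 2 := by
        have h1 : (2 : ℝ) ^ (j + 1) * (2 ^ n)⁻¹ ≤ 1 := by
          rw [← div_eq_mul_inv, div_le_one (by positivity)]
          exact pow_le_pow_right₀ one_le_two hj
        linarith [hx.2]
      rw [mul_zero, Real.rpow_zero, mul_one, abs_of_pos (by linarith)]
      exact Real.rpow_le_rpow_of_nonpos (by linarith) hx2 hγ.le

/-- A single term gives only the power `σ`. Applying that bound to each term of the sum at `K * 2 ^
n * v` shows that all `n` terms are at least `2 ^ (n σ) φ(v) / K`, and the number of terms is the
gain: `n * 2 ^ (n σ) φ(v) ≤ K² φ(K² 2 ^ n v)`. -/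
theorem IsYoungDensity.growthCondition_of_sum_le (hφ : IsYoungDensity φ) {K σ : ℝ} (hK : 0 < K)
    (h : ∀ (n : ℕ) (v : ℝ), 0 < v →
      ∑ j ∈ Finset.range n, 2 ^ (j * σ) * φ (v / 2 ^ j) ≤ K * φ (K * v)) :
    GrowthCondition φ σ := by
  have hterm : ∀ (j : ℕ) (v : ℝ), 0 < v → 2 ^ (j * σ) * φ v ≤ K * φ (K * (2 ^ j * v)) := by
    intro j v hv
    have h1 := h (j + 1) (2 ^ j * v) (by positivity)
    refine le_trans ?_ h1
    have h2 := Finset.single_le_sum (f := fun i : ℕ => 2 ^ (i * σ) * φ (2 ^ j * v / 2 ^ i))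
      (fun i _ => mul_nonneg (by positivity) (hφ.nonneg (by positivity))) (Finset.self_mem_range_succ j)
    simpa using h2
  -- For `B = K ^ 2 * 2 ^ n`, the first bound makes the factor `n` pay for `K ^ 2`, the `2` and the
  -- excess `(K ^ 2) ^ σ` in `B ^ σ`; the second gives `B > 1`.
  obtain ⟨n, hn⟩ := (((tendsto_natCast_atTop_atTop (R := ℝ)).eventually_ge_atTop
    (K ^ 2 * (2 * (K ^ 2) ^ σ))).and
    ((tendsto_pow_atTop_atTop_of_one_lt (one_lt_two (α := ℝ))).eventually_gt_atTop
      (1 / K ^ 2))).exists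
  refine ⟨K ^ 2 * 2 ^ n, (div_lt_iff₀' (by positivity)).1 hn.2, fun v hv => ?_⟩
  have hv0 := hφ.nonneg hv
  have h1 : n * (2 ^ (n * σ) * φ v) ≤ K * (K * φ (K * (K * (2 ^ n * v)))) := by
    calc _ = ∑ j ∈ Finset.range n, 2 ^ (n * σ) * φ v := by simp
      _ ≤ ∑ j ∈ Finset.range n, K * (2 ^ (j * σ) * φ (K * (2 ^ n * v) / 2 ^ j)) := by
        refine Finset.sum_le_sum fun j hj => ?_
        have hj' := (Finset.mem_range.1 hj).le
        obtain ⟨m, rfl⟩ := Nat.exists_eq_add_of_le hj'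
        have e : K * (2 ^ (j + m) * v) / 2 ^ j = K * (2 ^ m * v) := by
          rw [pow_add]; field_simp
        rw [e, Nat.cast_add, add_mul, Real.rpow_add two_pos, mul_assoc, mul_left_comm K]
        exact mul_le_mul_of_nonneg_left (hterm m v hv) (by positivity)
      _ = K * ∑ j ∈ Finset.range n, 2 ^ (j * σ) * φ (K * (2 ^ n * v) / 2 ^ j) := by
        rw [Finset.mul_sum]
      _ ≤ _ := mul_le_mul_of_nonneg_left (h n _ (by positivity)) hK.le
  have e : K * (K * (2 ^ n * v)) = K ^ 2 * 2 ^ n * v := by ring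
  rw [e] at h1
  rw [Real.mul_rpow (by positivity) (by positivity), ← Real.rpow_natCast_mul two_pos.le]
  have h2 : K ^ 2 * (2 * (K ^ 2) ^ σ) * (2 ^ (n * σ) * φ v) ≤ n * (2 ^ (n * σ) * φ v) :=
    mul_le_mul_of_nonneg_right hn.1 (by positivity)
  refine le_of_mul_le_mul_left (a := K ^ 2) ?_ (by positivity)
  calc _ = K ^ 2 * (2 * (K ^ 2) ^ σ) * (2 ^ (n * σ) * φ v) := by ring
    _ ≤ K * (K * φ (K ^ 2 * 2 ^ n * v)) := h2.trans h1
    _ = _ := by ring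

theorem ModularBounded.growthCondition (hφ : IsYoungDensity φ) (h : ModularBounded φ γ) :
    GrowthCondition φ (max γ 0) := by
  obtain ⟨K, hK, h⟩ := h.exists_sum_density_le hφ
  exact hφ.growthCondition_of_sum_le hK h

/-! ### Power weights in `A_p` and the weighted weak type inequality. -/

theorem setLIntegral_Icc_zero_rpow {α : ℝ} (hα : -1 < α) {M : ℝ} (hM : 0 ≤ M) :
    ∫⁻ x in Icc 0 M, ENNReal.ofReal (|x| ^ α) = ENNReal.ofReal (M ^ (α + 1) / (α + 1)) := by
  have hint := intervalIntegral.intervalIntegrable_rpow' (a := 0) (b := M) hα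
  rw [intervalIntegrable_iff_integrableOn_Ioc_of_le hM] at hint
  rw [Measure.restrict_congr_set Ioc_ae_eq_Icc.symm,
    setLIntegral_congr_fun (g := fun x => ENNReal.ofReal (x ^ α)) measurableSet_Ioc fun x hx => by
      simp only [abs_of_pos hx.1],
    ← ofReal_integral_eq_lintegral_ofReal hint
      ((ae_restrict_iff' measurableSet_Ioc).2 (Eventually.of_forall fun x hx =>
        Real.rpow_nonneg hx.1.le _)),
    ← intervalIntegral.integral_of_le hM, integral_rpow (Or.inl hα),
    Real.zero_rpow (by linarith), sub_zero]

theorem setLIntegral_symm_rpow_le {α : ℝ} (hα : -1 < α) {M : ℝ} (hM : 0 ≤ M) :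
    ∫⁻ x in Icc (-M) M, ENNReal.ofReal (|x| ^ α) ≤
      ENNReal.ofReal (2 * (M ^ (α + 1) / (α + 1))) := by
  have hneg : ∫⁻ x in Icc (-M) 0, ENNReal.ofReal (|x| ^ α) =
      ∫⁻ x in Icc 0 M, ENNReal.ofReal (|x| ^ α) := by
    rw [← lintegral_indicator measurableSet_Icc, ← lintegral_indicator measurableSet_Icc,
      ← lintegral_neg_eq_self]
    refine lintegral_congr fun x => ?_
    simp only [indicator, abs_neg, mem_Icc, neg_le_neg_iff, Left.neg_nonpos_iff, and_comm]
  have h0 : 0 ≤ M ^ (α + 1) / (α + 1) := div_nonneg (by positivity) (by linarith)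
  calc _ ≤ ∫⁻ x in Icc (-M) 0 ∪ Icc 0 M, ENNReal.ofReal (|x| ^ α) :=
        lintegral_mono_set (Icc_union_Icc_eq_Icc (by linarith) hM).ge
    _ ≤ _ := lintegral_union_le _ _ _
    _ = _ := by
      rw [hneg, setLIntegral_Icc_zero_rpow hα hM, ← ENNReal.ofReal_add h0 h0, two_mul]

theorem abs_le_max_abs_of_mem_Icc {a b x : ℝ} (hx : x ∈ Icc a b) : |x| ≤ max |a| |b| :=
  abs_le_max_abs_abs hx.1 hx.2

theorem max_abs_pos {a b : ℝ} (hab : a < b) : 0 < max |a| |b| := by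
  rcases eq_or_ne a 0 with rfl | h
  · exact lt_max_of_lt_right (abs_pos.2 hab.ne')
  · exact lt_max_of_lt_left (abs_pos.2 h)

theorem exists_setLIntegral_rpow_le {α : ℝ} (hα : -1 < α) :
    ∃ C : ℝ, 0 < C ∧ ∀ a b : ℝ, a < b → ∫⁻ x in Icc a b, ENNReal.ofReal (|x| ^ α) ≤
      ENNReal.ofReal (C * (b - a) * max |a| |b| ^ α) := by
  have hconst : ∀ {a b m : ℝ}, a < b → (∀ x ∈ Icc a b, |x| ^ α ≤ m) →
      ∫⁻ x in Icc a b, ENNReal.ofReal (|x| ^ α) ≤ ENNReal.ofReal ((b - a) * m) := by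
    intro a b m hab h
    calc _ ≤ ∫⁻ _ in Icc a b, ENNReal.ofReal m := setLIntegral_mono' measurableSet_Icc fun x hx =>
          ENNReal.ofReal_le_ofReal (h x hx)
      _ = _ := by
        rw [setLIntegral_const, Real.volume_Icc, mul_comm, ENNReal.ofReal_mul (by linarith)]
  rcases le_or_gt 0 α with h0 | h0
  · refine ⟨1, one_pos, fun a b hab => ?_⟩
    rw [one_mul]
    exact hconst hab fun x hx =>
      Real.rpow_le_rpow (abs_nonneg x) (abs_le_max_abs_of_mem_Icc hx) h0
  have hα1 : 0 < α + 1 := by linarith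
  refine ⟨4 / (α + 1) + 2 ^ (-α), by positivity, fun a b hab => ?_⟩
  set M := max |a| |b| with hM
  have hM0 : 0 < M := max_abs_pos hab
  have hba : 0 < b - a := by linarith
  -- Either the interval is long relative to its distance from the origin and is enlarged to `[-M,
  -- M]`, or `|x| ≥ M / 2` on all of it and the weight is nearly constant.
  rcases le_or_gt M (2 * (b - a)) with hn | hf
  · calc _ ≤ ∫⁻ x in Icc (-M) M, ENNReal.ofReal (|x| ^ α) := lintegral_mono_set fun x hx =>
          abs_le.1 (abs_le_max_abs_of_mem_Icc hx)
      _ ≤ _ := setLIntegral_symm_rpow_le hα hM0.le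
      _ ≤ _ := by
        refine ENNReal.ofReal_le_ofReal ?_
        rw [Real.rpow_add_one hM0.ne']
        calc 2 * (M ^ α * M / (α + 1)) ≤ 2 * (M ^ α * (2 * (b - a)) / (α + 1)) := by gcongr
          _ = 4 / (α + 1) * (b - a) * M ^ α := by ring
          _ ≤ _ := by
            gcongr
            exact le_add_of_nonneg_right (by positivity)
  · refine (hconst (m := 2 ^ (-α) * M ^ α) hab fun x hx => ?_).trans (ENNReal.ofReal_le_ofReal ?_)
    · have hx2 : M / 2 ≤ |x| := by
        have h1 : |a| ≤ |x| + (b - a) := by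
          calc |a| = |x + (a - x)| := by ring_nf
            _ ≤ |x| + |a - x| := abs_add_le _ _
            _ ≤ _ := by gcongr; rw [abs_le]; constructor <;> linarith [hx.1, hx.2]
        have h2 : |b| ≤ |x| + (b - a) := by
          calc |b| = |x + (b - x)| := by ring_nf
            _ ≤ |x| + |b - x| := abs_add_le _ _
            _ ≤ _ := by gcongr; rw [abs_le]; constructor <;> linarith [hx.1, hx.2]
        have h3 : M ≤ |x| + (b - a) := max_le h1 h2
        linarith
      calc |x| ^ α ≤ (M / 2) ^ α := Real.rpow_le_rpow_of_nonpos (by positivity) hx2 h0.le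
        _ = _ := by
          rw [Real.div_rpow hM0.le two_pos.le, Real.rpow_neg two_pos.le, div_eq_inv_mul]
    · calc (b - a) * (2 ^ (-α) * M ^ α) = 2 ^ (-α) * (b - a) * M ^ α := by ring
        _ ≤ _ := by
          gcongr
          exact le_add_of_nonneg_left (by positivity)

theorem setLIntegral_rpow_le_holder {p : ℝ} (hp : 1 < p) {F : ℝ → ℝ≥0∞} (hF : Measurable F)
    (γ : ℝ) (S : Set ℝ) :
    (∫⁻ x in S, F x) ^ p ≤ (∫⁻ x in S, F x ^ p * ENNReal.ofReal (|x| ^ γ)) *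
      (∫⁻ x in S, ENNReal.ofReal (|x| ^ (-γ / (p - 1)))) ^ (p - 1) := by
  have hp0 : 0 < p := by linarith
  have hp1 : 0 < p - 1 := by linarith
  have hpq := Real.HolderConjugate.conjExponent hp
  set q := p.conjExponent with hq
  have hq0 : 0 < q := hpq.symm.pos
  have hqe : q = p / (p - 1) := rfl
  have h1 := ENNReal.lintegral_mul_le_Lp_mul_Lq (volume.restrict S) hpq
    (f := fun x => F x * ENNReal.ofReal (|x| ^ (γ / p)))
    (g := fun x => ENNReal.ofReal (|x| ^ (-γ / p)))
    (by fun_prop) (by fun_prop)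
  have e1 : ∫⁻ x in S, F x = ∫⁻ x in S, ((fun x => F x * ENNReal.ofReal (|x| ^ (γ / p))) *
      fun x => ENNReal.ofReal (|x| ^ (-γ / p))) x := by
    refine lintegral_congr_ae (ae_restrict_of_ae ?_)
    filter_upwards [Measure.ae_ne volume (0 : ℝ)] with x hx
    rw [Pi.mul_apply, mul_assoc, ← ENNReal.ofReal_mul (by positivity),
      ← Real.rpow_add (abs_pos.2 hx), neg_div, add_neg_cancel, Real.rpow_zero, ENNReal.ofReal_one,
      mul_one]
  have e2 : ∫⁻ x in S, (F x * ENNReal.ofReal (|x| ^ (γ / p))) ^ p =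
      ∫⁻ x in S, F x ^ p * ENNReal.ofReal (|x| ^ γ) := by
    refine lintegral_congr fun x => ?_
    rw [ENNReal.mul_rpow_of_nonneg _ _ hp0.le, ENNReal.ofReal_rpow_of_nonneg (by positivity) hp0.le,
      ← Real.rpow_mul (abs_nonneg x), div_mul_cancel₀ _ hp0.ne']
  have e3 : ∫⁻ x in S, (ENNReal.ofReal (|x| ^ (-γ / p))) ^ q =
      ∫⁻ x in S, ENNReal.ofReal (|x| ^ (-γ / (p - 1))) := by
    refine lintegral_congr fun x => ?_
    rw [ENNReal.ofReal_rpow_of_nonneg (by positivity) hq0.le, ← Real.rpow_mul (abs_nonneg x), hqe]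
    congr 2
    field_simp
  rw [← e1] at h1
  simp only [e2, e3] at h1
  calc _ ≤ (_ * _) ^ p := ENNReal.rpow_le_rpow h1 hp0.le
    _ = _ := by
      rw [ENNReal.mul_rpow_of_nonneg _ _ hp0.le, ← ENNReal.rpow_mul, ← ENNReal.rpow_mul,
        one_div_mul_cancel hp0.ne', ENNReal.rpow_one]
      congr 2
      rw [hqe]
      field_simp

/-- The range of `γ` makes both `γ` and the dual exponent `-γ / (p - 1)` exceed `-1`; in the product
the powers of `max |a| |b|` cancel. The subset `S` is there for the covering argument: a ball inside
its fivefold enlargement. -/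
theorem exists_muckenhoupt {p : ℝ} (hp : 1 < p) (hγ : -1 < γ) (hγp : γ < p - 1) :
    ∃ C : ℝ, 0 < C ∧ ∀ F : ℝ → ℝ≥0∞, Measurable F → ∀ a b : ℝ, a < b → ∀ S ⊆ Icc a b,
      (∫⁻ x in S, F x) ^ p * ∫⁻ x in Icc a b, ENNReal.ofReal (|x| ^ γ) ≤
        ENNReal.ofReal (C * (b - a) ^ p) * ∫⁻ x in S, F x ^ p * ENNReal.ofReal (|x| ^ γ) := by
  have hp1 : 0 < p - 1 := by linarith
  obtain ⟨C₁, hC₁, h₁⟩ := exists_setLIntegral_rpow_le hγ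
  have hβ : -1 < -γ / (p - 1) := by rw [lt_div_iff₀ hp1]; linarith
  obtain ⟨C₂, hC₂, h₂⟩ := exists_setLIntegral_rpow_le hβ
  refine ⟨C₂ ^ (p - 1) * C₁, by positivity, fun F hF a b hab S hS => ?_⟩
  have hba : 0 < b - a := by linarith
  have hM := max_abs_pos hab
  set M := max |a| |b|
  calc _ ≤ (∫⁻ x in S, F x ^ p * ENNReal.ofReal (|x| ^ γ)) *
        (ENNReal.ofReal (C₂ * (b - a) * M ^ (-γ / (p - 1)))) ^ (p - 1) *
          ENNReal.ofReal (C₁ * (b - a) * M ^ γ) := by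
        refine mul_le_mul' ((setLIntegral_rpow_le_holder hp hF γ S).trans ?_) (h₁ a b hab)
        exact mul_le_mul_right (ENNReal.rpow_le_rpow
          ((lintegral_mono_set hS).trans (h₂ a b hab)) hp1.le) _
    _ = _ := by
        rw [mul_comm _ (∫⁻ x in S, F x ^ p * ENNReal.ofReal (|x| ^ γ)), mul_assoc,
          ENNReal.ofReal_rpow_of_nonneg (by positivity) hp1.le, ← ENNReal.ofReal_mul (by positivity)]
        congr 2
        rw [Real.mul_rpow (by positivity) (by positivity), Real.mul_rpow hC₂.le hba.le,
          ← Real.rpow_mul hM.le, div_mul_cancel₀ _ hp1.ne', Real.rpow_neg hM.le,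
          Real.rpow_sub_one hba.ne']
        field_simp

theorem exists_weak_type {p : ℝ} (hp : 1 < p) (hγ : -1 < γ) (hγp : γ < p - 1) :
    ∃ C : ℝ, 0 < C ∧ ∀ f : ℝ → ℝ, Measurable f → ∀ l : ℝ, 0 < l →
      ∫⁻ x in {x | ENNReal.ofReal l < maximalFn f x}, ENNReal.ofReal (|x| ^ γ) ≤
        ENNReal.ofReal (C * l ^ (-p)) *
          ∫⁻ x, ENNReal.ofReal |f x| ^ p * ENNReal.ofReal (|x| ^ γ) := by
  have hp0 : 0 < p := by linarith
  obtain ⟨C, hC, h⟩ := exists_muckenhoupt hp hγ hγp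
  refine ⟨C * 5 ^ p, by positivity, fun f hf l hl => ?_⟩
  set F : ℝ → ℝ≥0∞ := fun x => ENNReal.ofReal |f x| with hF
  have hFm : Measurable F := by fun_prop
  set μ : Measure ℝ := volume.withDensity fun x => ENNReal.ofReal (|x| ^ γ) with hμ
  rw [← withDensity_apply _ (isOpen_lt_maximalFn f _).measurableSet, ← hμ]
  set Q : ℝ≥0∞ := ENNReal.ofReal (C * 5 ^ p * l ^ (-p)) with hQ
  -- Centres and radii of balls with average at least `l`. The cap `N` serves the Vitali covering
  -- lemma, which needs bounded radii; it is removed at the end by monotone continuity of the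
  -- measure.
  set t : ℕ → Set (ℝ × ℝ) := fun N => {z | 0 < z.2 ∧ z.2 ≤ N ∧
    ENNReal.ofReal (l * (2 * z.2)) ≤ ∫⁻ y in Metric.closedBall z.1 z.2, F y} with ht
  have hball : ∀ N, ∀ z ∈ t N, μ (Metric.closedBall z.1 (5 * z.2)) ≤
      Q * ∫⁻ x in Metric.closedBall z.1 z.2, F x ^ p * ENNReal.ofReal (|x| ^ γ) := by
    rintro N ⟨x, r⟩ ⟨hr, -, hz⟩
    simp only at hr hz ⊢
    have h1 := h F hFm (x - 5 * r) (x + 5 * r) (by linarith) (Metric.closedBall x r) (by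
      rw [Real.closedBall_eq_Icc]; exact Icc_subset_Icc (by linarith) (by linarith))
    rw [Real.closedBall_eq_Icc (r := 5 * r), hμ, withDensity_apply _ measurableSet_Icc]
    have h2 : ENNReal.ofReal ((l * (2 * r)) ^ p) ≠ 0 := by
      rw [Ne, ENNReal.ofReal_eq_zero, not_le]; positivity
    rw [← ENNReal.mul_le_mul_iff_right h2 ENNReal.ofReal_ne_top]
    refine le_trans (mul_le_mul_left ?_ _) (h1.trans (le_of_eq ?_))
    · rw [← ENNReal.ofReal_rpow_of_nonneg (by positivity) hp0.le]
      exact ENNReal.rpow_le_rpow hz hp0.le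
    · rw [← mul_assoc, hQ, ← ENNReal.ofReal_mul (by positivity)]
      congr 2
      rw [show x + 5 * r - (x - 5 * r) = 5 * (2 * r) by ring, Real.mul_rpow (by positivity) (by positivity),
        Real.mul_rpow (x := l) hl.le (by positivity), Real.rpow_neg hl.le]
      field_simp
  have hN : ∀ N, μ (⋃ z ∈ t N, Metric.closedBall z.1 z.2) ≤
      Q * ∫⁻ x, F x ^ p * ENNReal.ofReal (|x| ^ γ) := by
    intro N
    obtain ⟨u, hut, hdisj, hcov⟩ := Vitali.exists_disjoint_subfamily_covering_enlargement_closedBall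
      (t N) Prod.fst Prod.snd N (fun z hz => hz.2.1) 5 (by norm_num)
    have hcount : u.Countable := hdisj.countable_of_nonempty_interior fun z hz => by
      have := (hut hz).1
      rw [interior_closedBall _ this.ne']
      exact Metric.nonempty_ball.2 this
    calc _ ≤ μ (⋃ z ∈ u, Metric.closedBall z.1 (5 * z.2)) := by
          refine measure_mono (iUnion₂_subset fun z hz => ?_)
          obtain ⟨z', hz', hsub⟩ := hcov z hz
          exact hsub.trans (subset_biUnion_of_mem (u := fun z : ℝ × ℝ =>
            Metric.closedBall z.1 (5 * z.2)) hz')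
      _ ≤ ∑' z : u, μ (Metric.closedBall z.1.1 (5 * z.1.2)) := measure_biUnion_le μ hcount _
      _ ≤ ∑' z : u, Q * ∫⁻ x in Metric.closedBall z.1.1 z.1.2, F x ^ p * ENNReal.ofReal (|x| ^ γ) :=
          ENNReal.tsum_le_tsum fun z => hball N z.1 (hut z.2)
      _ = Q * ∫⁻ x in ⋃ z ∈ u, Metric.closedBall z.1 z.2, F x ^ p * ENNReal.ofReal (|x| ^ γ) := by
          rw [ENNReal.tsum_mul_left, lintegral_biUnion hcount
            (fun z _ => Metric.isClosed_closedBall.measurableSet) hdisj]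
      _ ≤ _ := mul_le_mul_right (setLIntegral_le_lintegral _ _) _
  have hcover : {x | ENNReal.ofReal l < maximalFn f x} ⊆
      ⋃ N, ⋃ z ∈ t N, Metric.closedBall z.1 z.2 := by
    intro x hx
    obtain ⟨a, b, hab, hxab, hlt⟩ := lt_maximalFn_iff.1 hx
    have hba : 0 < (b - a) / 2 := by linarith
    obtain ⟨N, hN⟩ := exists_nat_ge ((b - a) / 2)
    have hIcc : Metric.closedBall ((a + b) / 2) ((b - a) / 2) = Icc a b := by
      rw [Real.closedBall_eq_Icc]; congr 1 <;> ring
    refine mem_iUnion.2 ⟨N, mem_iUnion₂.2 ⟨((a + b) / 2, (b - a) / 2), ⟨hba, hN, ?_⟩, ?_⟩⟩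
    · have h0 : ENNReal.ofReal (b - a) ≠ 0 := by
        rw [Ne, ENNReal.ofReal_eq_zero, not_le]; linarith
      simp only [hIcc]
      rw [show 2 * ((b - a) / 2) = b - a by ring, ENNReal.ofReal_mul hl.le]
      exact (ENNReal.le_div_iff_mul_le (Or.inl h0) (Or.inl ENNReal.ofReal_ne_top)).1 hlt.le
    · simpa only [hIcc] using hxab
  have hmono : Monotone fun N => ⋃ z ∈ t N, Metric.closedBall z.1 z.2 := fun m n hmn =>
    biUnion_subset_biUnion_left fun z hz => ⟨hz.1, hz.2.1.trans (by exact_mod_cast hmn), hz.2.2⟩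
  refine (measure_mono hcover).trans ?_
  rw [hmono.measure_iUnion]
  exact iSup_le hN

/-! ### From growth of `φ` to the modular inequality. -/

theorem IsYoungDensity.measurable_indicator (hφ : IsYoungDensity φ) :
    Measurable ((Ioi 0).indicator fun s => ENNReal.ofReal (φ s)) := by
  refine Monotone.measurable fun s t hst => ?_
  by_cases hs : s ∈ Ioi (0 : ℝ)
  · have ht : t ∈ Ioi (0 : ℝ) := lt_of_lt_of_le hs hst
    rw [indicator_of_mem hs, indicator_of_mem ht]
    exact ENNReal.ofReal_le_ofReal (hφ.monotoneOn hs ht hst)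
  · rw [indicator_of_notMem hs]
    exact zero_le

/-- Tonelli on the region below the graph of `G`. The factor `k` allows two uses: `k = 1` to unfold
the modular of `Mf`, and `k s = s ^ (-p)` to fold back the weak type bound. -/
theorem IsYoungDensity.lintegral_layer (hφ : IsYoungDensity φ) {G w : ℝ → ℝ≥0∞} {k : ℝ → ℝ≥0∞}
    (hG : Measurable G) (hw : Measurable w) (hk : Measurable k) :
    ∫⁻ x, (∫⁻ s in {s : ℝ | 0 < s ∧ ENNReal.ofReal s < G x}, ENNReal.ofReal (φ s) * k s) * w x =
      ∫⁻ s in Ioi 0, ENNReal.ofReal (φ s) * k s * ∫⁻ x in {x | ENNReal.ofReal s < G x}, w x := by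
  set φ₀ : ℝ → ℝ≥0∞ := (Ioi 0).indicator fun s => ENNReal.ofReal (φ s) with hφ₀
  have hm : Measurable φ₀ := hφ.measurable_indicator
  set A : Set (ℝ × ℝ) := {z | ENNReal.ofReal z.2 < G z.1} with hA
  have hAm : MeasurableSet A := measurableSet_lt
    (ENNReal.measurable_ofReal.comp measurable_snd) (hG.comp measurable_fst)
  set T : ℝ → ℝ → ℝ≥0∞ := fun x s => A.indicator (fun z => φ₀ z.2 * k z.2 * w z.1) (x, s) with hT
  have hTm : Measurable (Function.uncurry T) :=
    (((hm.comp measurable_snd).mul (hk.comp measurable_snd)).mul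
      (hw.comp measurable_fst)).indicator hAm
  have h1 : ∀ x, (∫⁻ s in {s : ℝ | 0 < s ∧ ENNReal.ofReal s < G x}, ENNReal.ofReal (φ s) * k s) * w x =
      ∫⁻ s, T x s := by
    intro x
    have hmeas := (hm.mul hk).indicator
      (measurableSet_lt ENNReal.measurable_ofReal (measurable_const (a := G x)))
    rw [← lintegral_indicator (measurableSet_youngCut _)]
    calc _ = (∫⁻ s, {s : ℝ | ENNReal.ofReal s < G x}.indicator (φ₀ * k) s) * w x := by
          congr 1
          refine lintegral_congr fun s => ?_
          by_cases h0 : 0 < s <;> by_cases h1 : ENNReal.ofReal s < G x <;>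
            simp [indicator, hφ₀, h0, h1]
      _ = ∫⁻ s, {s : ℝ | ENNReal.ofReal s < G x}.indicator (φ₀ * k) s * w x :=
          (lintegral_mul_const _ hmeas).symm
      _ = _ := by
          refine lintegral_congr fun s => ?_
          by_cases h1 : ENNReal.ofReal s < G x <;> simp [indicator, hT, hA, h1]
  have h2 : ∀ s, ∫⁻ x, T x s = (Ioi 0).indicator (fun s => ENNReal.ofReal (φ s) * k s *
      ∫⁻ x in {x | ENNReal.ofReal s < G x}, w x) s := by
    intro s
    have hS : MeasurableSet {x | ENNReal.ofReal s < G x} := measurableSet_lt measurable_const hG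
    calc _ = ∫⁻ x, φ₀ s * k s * {x | ENNReal.ofReal s < G x}.indicator w x := by
          refine lintegral_congr fun x => ?_
          by_cases h1 : ENNReal.ofReal s < G x <;> simp [indicator, hT, hA, h1]
      _ = φ₀ s * k s * ∫⁻ x in {x | ENNReal.ofReal s < G x}, w x := by
          rw [lintegral_const_mul _ (hw.indicator hS), lintegral_indicator hS]
      _ = _ := by by_cases h0 : 0 < s <;> simp [indicator, hφ₀, h0]
  rw [lintegral_congr h1, lintegral_lintegral_swap hTm.aemeasurable, lintegral_congr h2,
    lintegral_indicator measurableSet_Ioi]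

theorem GrowthCondition.exists_setLIntegral_le (hφ : IsYoungDensity φ) {σ : ℝ} (hσ : 0 ≤ σ)
    (h : GrowthCondition φ σ) : ∃ p C : ℝ, 1 + σ < p ∧ 0 < C ∧ ∀ u : ℝ, 0 < u →
      ∫⁻ s in Ioo 0 u, ENNReal.ofReal (φ s) * ENNReal.ofReal (s ^ (-p)) ≤
        ENNReal.ofReal (C * u ^ (-p)) * youngFn φ (ENNReal.ofReal (2 * u)) := by
  obtain ⟨B, hB, h⟩ := h
  have hB0 : 0 < B := by linarith
  -- Of the gain `2` in the growth condition, `3 / 2` is spent on raising `p` above `1 + σ`; the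
  -- ratio `(3 / 2) / 2 = 3 / 4` still makes the integral geometric.
  set θ : ℝ := Real.logb B (3 / 2) with hθ
  have hBθ : B ^ θ = 3 / 2 := Real.rpow_logb hB0 hB.ne' (by norm_num)
  set p : ℝ := 1 + σ + θ with hp
  have hBp : B ^ p = B * B ^ σ * (3 / 2) := by
    rw [hp, Real.rpow_add hB0, Real.rpow_add hB0, Real.rpow_one, hBθ]
  refine ⟨p, 4 * B ^ p, by linarith [Real.logb_pos hB (show (1 : ℝ) < 3 / 2 by norm_num)],
    by positivity, fun u hu => ?_⟩
  have hφu := hφ.nonneg hu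
  have hgeo := setLIntegral_le_of_geometric
    (h := fun s => ENNReal.ofReal (φ s) * ENNReal.ofReal (s ^ (-p))) (r := B⁻¹) (q := 3 / 4) (t := u)
    (inv_pos.2 hB0) (inv_lt_one_of_one_lt₀ hB) (by norm_num) (by norm_num) hu fun s hs => by
      have hs0 : 0 < s := hs.1
      have hs1 : 0 < B⁻¹ * s := by positivity
      have h1 := h (B⁻¹ * s) hs1
      rw [mul_inv_cancel_left₀ hB0.ne'] at h1
      have h3 := hφ.nonneg hs1
      rw [← ENNReal.ofReal_mul h3, ← ENNReal.ofReal_mul (hφ.nonneg hs0),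
        ← ENNReal.ofReal_mul (inv_nonneg.2 hB0.le), ← ENNReal.ofReal_mul (by norm_num)]
      refine ENNReal.ofReal_le_ofReal ?_
      rw [Real.mul_rpow (by positivity) hs0.le, Real.inv_rpow hB0.le, Real.rpow_neg hB0.le, inv_inv,
        hBp]
      calc B⁻¹ * (φ (B⁻¹ * s) * (B * B ^ σ * (3 / 2) * s ^ (-p)))
          = 3 / 4 * ((2 * B ^ σ * φ (B⁻¹ * s)) * s ^ (-p)) := by field_simp; norm_num
        _ ≤ _ := by gcongr
  refine hgeo.trans ?_
  calc _ ≤ ENNReal.ofReal (1 - 3 / 4)⁻¹ * ∫⁻ _ in Ico (B⁻¹ * u) u,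
        ENNReal.ofReal (φ u * (B⁻¹ * u) ^ (-p)) := by
        refine mul_le_mul_right (setLIntegral_mono' measurableSet_Ico fun s hs => ?_) _
        have hu' : 0 < B⁻¹ * u := by positivity
        have hs0 : 0 < s := hu'.trans_le hs.1
        have hθ0 : 0 < θ := Real.logb_pos hB (by norm_num)
        rw [ENNReal.ofReal_mul hφu]
        exact mul_le_mul' (ENNReal.ofReal_le_ofReal (hφ.monotoneOn hs0 hu hs.2.le))
          (ENNReal.ofReal_le_ofReal (Real.rpow_le_rpow_of_nonpos hu' hs.1 (by linarith)))
    _ = ENNReal.ofReal (1 - 3 / 4)⁻¹ *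
        (ENNReal.ofReal (φ u * (B⁻¹ * u) ^ (-p)) * ENNReal.ofReal (u - B⁻¹ * u)) := by
        rw [setLIntegral_const, Real.volume_Ico]
    _ ≤ ENNReal.ofReal (1 - 3 / 4)⁻¹ *
        (ENNReal.ofReal (φ u * (B⁻¹ * u) ^ (-p)) * ENNReal.ofReal u) := by
        gcongr
        have : 0 < B⁻¹ * u := by positivity
        linarith
    _ = ENNReal.ofReal (4 * B ^ p * u ^ (-p)) * ENNReal.ofReal (u * φ u) := by
        rw [← ENNReal.ofReal_mul (by positivity), ← ENNReal.ofReal_mul (by norm_num),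
          ← ENNReal.ofReal_mul (by positivity), Real.mul_rpow (by positivity) hu.le,
          Real.inv_rpow hB0.le, Real.rpow_neg hB0.le, inv_inv]
        congr 1
        ring
    _ ≤ _ := mul_le_mul_right (le_youngFn_two_mul hφ.monotoneOn hu) _

theorem maximalFn_le_truncation (f : ℝ → ℝ) (l : ℝ) (x : ℝ) :
    maximalFn f x ≤ maximalFn ({y | l < |f y|}.indicator f) x + ENNReal.ofReal l := by
  refine maximalFn_le fun a b hab hx => ?_
  refine le_trans ?_ (add_le_add (le_maximalFn _ hab hx) le_rfl)
  have hba : ENNReal.ofReal (b - a) ≠ 0 := by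
    rw [Ne, ENNReal.ofReal_eq_zero, not_le]; linarith
  have h1 : ∫⁻ y in Icc a b, ENNReal.ofReal |f y| ≤
      (∫⁻ y in Icc a b, ENNReal.ofReal |{y | l < |f y|}.indicator f y|) +
        ENNReal.ofReal l * ENNReal.ofReal (b - a) := by
    rw [← Real.volume_Icc, ← setLIntegral_const, ← lintegral_add_right _ measurable_const]
    refine lintegral_mono fun y => ?_
    by_cases hy : l < |f y|
    · rw [indicator_of_mem (by exact hy)]
      exact le_self_add
    · exact (ENNReal.ofReal_le_ofReal (not_lt.1 hy)).trans le_add_self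
  refine (ENNReal.div_le_div_right h1 _).trans ?_
  rw [ENNReal.add_div, ENNReal.mul_div_cancel_right hba ENNReal.ofReal_ne_top]

/-- The part of `f` below `s / 2` contributes at most `s / 2` to `Mf`, so where `Mf > s` the part
above `s / 2` has maximal function exceeding `s / 2`. -/
theorem exists_weak_type_truncated {p : ℝ} (hp : 1 < p) (hγ : -1 < γ) (hγp : γ < p - 1) :
    ∃ C : ℝ, 0 < C ∧ ∀ f : ℝ → ℝ, Measurable f → ∀ s : ℝ, 0 < s →
      ∫⁻ x in {x | ENNReal.ofReal s < maximalFn f x}, ENNReal.ofReal (|x| ^ γ) ≤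
        ENNReal.ofReal C * ENNReal.ofReal (s ^ (-p)) *
          ∫⁻ x in {x | ENNReal.ofReal s < ENNReal.ofReal (2 * |f x|)},
            ENNReal.ofReal |f x| ^ p * ENNReal.ofReal (|x| ^ γ) := by
  have hp0 : 0 < p := by linarith
  obtain ⟨C, hC, h⟩ := exists_weak_type hp hγ hγp
  refine ⟨C * 2 ^ p, by positivity, fun f hf s hs => ?_⟩
  have hs2 : 0 < s / 2 := by linarith
  have hset : {x | ENNReal.ofReal s < ENNReal.ofReal (2 * |f x|)} = {x | s / 2 < |f x|} := by
    ext x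
    simp only [mem_ofPred_eq]
    rw [ENNReal.ofReal_lt_ofReal_iff_of_nonneg hs.le, div_lt_iff₀' two_pos]
  have hS : MeasurableSet {x | s / 2 < |f x|} := measurableSet_lt measurable_const hf.abs
  have hsub : {x | ENNReal.ofReal s < maximalFn f x} ⊆
      {x | ENNReal.ofReal (s / 2) < maximalFn ({y | s / 2 < |f y|}.indicator f) x} := by
    intro x hx
    simp only [mem_ofPred_eq] at hx ⊢
    by_contra! hcon
    have h1 := (maximalFn_le_truncation f (s / 2) x).trans (add_le_add hcon le_rfl)
    rw [← ENNReal.ofReal_add hs2.le hs2.le, add_halves] at h1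
    exact absurd hx (not_lt.2 h1)
  refine (lintegral_mono_set hsub).trans ((h _ (hf.indicator hS) _ hs2).trans (le_of_eq ?_))
  rw [hset, ← lintegral_indicator hS, ← ENNReal.ofReal_mul (by positivity)]
  congr 1
  · rw [Real.div_rpow hs.le two_pos.le, Real.rpow_neg two_pos.le]
    congr 1
    field_simp
  · refine lintegral_congr fun x => ?_
    by_cases hx : s / 2 < |f x| <;> simp [indicator, hx, hp0]

theorem GrowthCondition.modularBounded (hφ : IsYoungDensity φ) (hγ : -1 < γ)
    (h : GrowthCondition φ (max γ 0)) : ModularBounded φ γ := by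
  obtain ⟨p, C₁, hp, hC₁, hkey⟩ := h.exists_setLIntegral_le hφ (le_max_right _ _)
  have hp1 : 1 < p := by linarith [le_max_right γ 0]
  have hp0 : 0 < p := by linarith
  obtain ⟨C₂, hC₂, hweak⟩ := exists_weak_type_truncated hp1 hγ (by linarith [le_max_left γ 0])
  set D : ℝ := max 1 (C₂ * (C₁ * 2 ^ (-p))) with hD
  have hD1 : 1 ≤ D := le_max_left _ _
  refine ⟨D * 4, by positivity, fun f hf => ?_⟩
  wlog hfm : Measurable f generalizing f
  · have h1 := this (hf.mk f) hf.measurable_mk.aemeasurable hf.measurable_mk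
    rw [maximalFn_congr_ae hf.ae_eq_mk]
    refine h1.trans (modular_mono_ae (hf.ae_eq_mk.mono fun x hx => ?_))
    rw [hx]
  have hw := measurable_weight γ
  have hFp : Measurable fun x => ENNReal.ofReal |f x| ^ p * ENNReal.ofReal (|x| ^ γ) := by fun_prop
  have hkm : Measurable fun s : ℝ => ENNReal.ofReal (s ^ (-p)) := by fun_prop
  have hlayer := hφ.lintegral_layer (measurable_maximalFn f) hw (measurable_const (a := (1 : ℝ≥0∞)))
  simp only [mul_one] at hlayer
  calc modular φ γ (maximalFn f)
      = ∫⁻ s in Ioi 0, ENNReal.ofReal (φ s) *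
          ∫⁻ x in {x | ENNReal.ofReal s < maximalFn f x}, ENNReal.ofReal (|x| ^ γ) := hlayer
    _ ≤ ∫⁻ s in Ioi 0, ENNReal.ofReal C₂ * (ENNReal.ofReal (φ s) * ENNReal.ofReal (s ^ (-p)) *
          ∫⁻ x in {x | ENNReal.ofReal s < ENNReal.ofReal (2 * |f x|)},
            ENNReal.ofReal |f x| ^ p * ENNReal.ofReal (|x| ^ γ)) := by
        refine setLIntegral_mono' measurableSet_Ioi fun s hs => ?_
        refine (mul_le_mul_right (hweak f hfm s hs) _).trans (le_of_eq ?_)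
        ring
    _ = ENNReal.ofReal C₂ * ∫⁻ x, (∫⁻ s in {s : ℝ | 0 < s ∧ ENNReal.ofReal s < ENNReal.ofReal (2 * |f x|)},
          ENNReal.ofReal (φ s) * ENNReal.ofReal (s ^ (-p))) *
            (ENNReal.ofReal |f x| ^ p * ENNReal.ofReal (|x| ^ γ)) := by
        rw [lintegral_const_mul' _ _ ENNReal.ofReal_ne_top,
          hφ.lintegral_layer (by fun_prop) hFp hkm]
    _ ≤ ENNReal.ofReal C₂ * ∫⁻ x, ENNReal.ofReal (C₁ * 2 ^ (-p)) *
          (youngFn φ (ENNReal.ofReal (4 * |f x|)) * ENNReal.ofReal (|x| ^ γ)) := by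
        refine mul_le_mul_right (lintegral_mono fun x => ?_) _
        simp only [youngCut_ofReal]
        rw [← mul_assoc, ← mul_assoc]
        refine mul_le_mul_left ?_ _
        rcases eq_or_lt_of_le (abs_nonneg (f x)) with h0 | h0
        · simp [← h0, hp0]
        refine (mul_le_mul_left (hkey (2 * |f x|) (by positivity)) _).trans (le_of_eq ?_)
        rw [ENNReal.ofReal_rpow_of_nonneg h0.le hp0.le, mul_right_comm,
          ← ENNReal.ofReal_mul (by positivity), ← mul_assoc 2 2, Real.mul_rpow two_pos.le h0.le,
          Real.rpow_neg h0.le]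
        congr 2
        · field_simp
        · norm_num
    _ = ENNReal.ofReal (C₂ * (C₁ * 2 ^ (-p))) *
          modular φ γ (fun x => ENNReal.ofReal (4 * |f x|)) := by
        rw [lintegral_const_mul' _ _ ENNReal.ofReal_ne_top, ← mul_assoc, ← ENNReal.ofReal_mul hC₂.le]
        rfl
    _ ≤ ENNReal.ofReal D * modular φ γ (fun x => ENNReal.ofReal (4 * |f x|)) := by
        gcongr
        exact le_max_right _ _
    -- Since `Φ` is superlinear under factors at least one, the outer constant moves inside; this is
    -- why `D` is taken at least `1`.
    _ ≤ modular φ γ (fun x => ENNReal.ofReal D * ENNReal.ofReal (4 * |f x|)) :=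
        mul_modular_le hφ.monotoneOn hD1 _
    _ = _ := by
        congr 1
        funext x
        rw [← ENNReal.ofReal_mul (by linarith), mul_assoc]

end PowerOrlicz

end

theorem mainTheorem3 (γ : ℝ) (hγ : -1 < γ) (φ : ℝ → ℝ) (hφ : PowerOrlicz.IsYoungDensity φ) :
    List.TFAE [
      -- the norm inequality
      ∃ L : ℝ, 0 < L ∧ ∀ f : ℝ → ℝ, AEMeasurable f volume →
        PowerOrlicz.luxNorm φ γ (PowerOrlicz.maximalFn f) ≤
          ENNReal.ofReal L * PowerOrlicz.luxNorm φ γ (fun x => ENNReal.ofReal |f x|),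
      -- the mapping property
      PowerOrlicz.MapsClass φ γ,
      -- the mapping property, with continuity
      PowerOrlicz.MapsClass φ γ ∧ PowerOrlicz.ContinuousOnClass φ γ,
      -- the modular inequality
      ∃ K : ℝ, 0 < K ∧ ∀ f : ℝ → ℝ, AEMeasurable f volume →
        PowerOrlicz.modular φ γ (PowerOrlicz.maximalFn f) ≤
          PowerOrlicz.modular φ γ (fun x => ENNReal.ofReal (K * |f x|)),
      -- the condition on the Young functions and the weight
      ∃ C : ℝ, 1 ≤ C ∧
        (∀ t : ℝ, 0 < t →
          PowerOrlicz.complYoungFn φ (ENNReal.ofReal (2 * t)) ≤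
            ENNReal.ofReal C * PowerOrlicz.complYoungFn φ (ENNReal.ofReal t)) ∧
        ((-1 < γ ∧ γ < 0) ∨
          (0 ≤ γ ∧ ∀ t : ℝ, 0 < t →
            (ENNReal.ofReal t)⁻¹ *
                ∫⁻ s in Ioo 0 t, ENNReal.ofReal (PowerOrlicz.densityInv φ (s ^ (-γ))) ≤
              ENNReal.ofReal (C * PowerOrlicz.densityInv φ (C * t ^ (-γ)))))] := by
  change List.TFAE [PowerOrlicz.NormBounded φ γ, PowerOrlicz.MapsClass φ γ,
    PowerOrlicz.MapsClass φ γ ∧ PowerOrlicz.ContinuousOnClass φ γ,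
    PowerOrlicz.ModularBounded φ γ, PowerOrlicz.ComplementaryCondition φ γ]
  tfae_have 1 → 3 := fun h => ⟨h.mapsClass hφ, h.continuousOnClass hφ⟩
  tfae_have 3 → 2 := And.left
  tfae_have 2 → 4 := fun h => (h.boundedOnUnitBall hφ).modularBounded hγ
  tfae_have 4 → 1 := PowerOrlicz.ModularBounded.normBounded
  tfae_have 4 → 5 := fun h => (h.growthCondition hφ).complementaryCondition hφ hγ
  tfae_have 5 → 4 := fun h => (h.growthCondition hφ).modularBounded hφ hγ
  tfae_finish
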